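/- Consider $\min_{x\in\mathbb{R}^{N_2}} H(x) := f(x)+h(x)$ with $f=F\circ G$, $F=\frac1{n_1}\sum_{i=1}^{n_1}F_i$, $G=\frac1{n_2}\sum_{j=1}^{n_2}G_j$, $n_1,n_2\ge 1$, where $F_i:\mathbb{R}^{N_1}\to\mathbb{R}$ and $G_j:\mathbb{R}^{N_2}\to\mathbb{R}^{N_1}$ are differentiable, $f$ is convex, and $h:\mathbb{R}^{N_2}\to(-\infty,+\infty]$ is proper, closed and convex. Assume that each $\nabla F_i$ is $L_F$-Lipschitz with $\|\nabla F_i\|\le B_F$, that each Jacobian $\nabla G_j$ is $L_G$-Lipschitz with $\|\nabla G_j\|\le B_G$ (spectral norm), and that $x\mapsto[\nabla G_j(x)]^\top\nabla F_i(G(x))$ is $L$-Lipschitz for all $i,j$. Let $x^*$ be a minimizer of $H$, $H(x_0)-H(x^*)\le D_H$, $\|x_0-x^*\|^2\le D_x$ with $D_x>0$, and put $\mu_0=D_H/D_x$, where $\mu_0\le L$. SoCK (Option I) with $S$ outer loops, applied to $\min f+\phi$ with $\phi$ being $\mu$-strongly convex, from a point $x$: set $m=\lceil\frac12\sqrt{L/\mu}\rceil$,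 $\tau_1=\tau_2=\frac1{2m}$, $\theta=1+\frac1{12m}$, $\alpha=\frac1{3\tau_1L}$, $A=\max\{1,\lceil 720B_G^4L_F^2/\mu^2\rceil\}$, $B=\max\{1,\lceil 720B_F^2L_G^2/\mu^2\rceil\}$ and $\tilde x^0=z_0=y_0=x$. For $s=0,\dots,S-1$: compute $G(\tilde x^s)$, $\nabla G(\tilde x^s)$ and $\nabla F(G(\tilde x^s))$; for $k=sm,\dots,sm+m-1$ let $x_{k+1}=\tau_1z_k+\tau_2\tilde x^s+(1-\tau_1-\tau_2)y_k$, draw independently and uniformly with replacement $A$ indices $\mathcal A_k$ and $B$ indices $\mathcal B_k$ from $\{1,\dots,n_2\}$, let $\hat G_k=G(\tilde x^s)+\frac1A\sum_{j\in\mathcal A_k}(G_j(x_{k+1})-G_j(\tilde x^s))$, $\hat J_k=\nabla G(\tilde x^s)+\frac1B\sum_{j\in\mathcal B_k}(\nabla G_j(x_{k+1})-\nabla G_j(\tilde x^s))$, $\tilde\nabla_{k+1}=\hat J_k^\top\nabla F(\hat G_k)$, $z_{k+1}=\arg\min_z\langle\tilde\nabla_{k+1},z\rangle+\frac1{2\alpha}\|z-z_k\|^2+\phi(z)$,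 $y_{k+1}=\arg\min_y\langle\tilde\nabla_{k+1},y\rangle+\frac{3L}2\|y-x_{k+1}\|^2+\phi(y)$; then let $\tilde x^{s+1}=(\sum_{j=0}^{m-1}\theta^j)^{-1}\sum_{j=0}^{m-1}\theta^jy_{sm+j+1}$. Return $\tilde x^S$. NoCK: for $t=0,\dots,T-1$ let $x_{t+1}$ be the output of SoCK with $S$ outer loops and $\mu=\mu_t:=\mu_0/2^t$, started at $x_t$, on $H_t(x):=H(x)+\frac{\mu_t}2\|x-x_0\|^2$ (that is, $\phi=h+\frac{\mu_t}2\|\cdot-x_0\|^2$). Return $x_T$. There are absolute constants $S\in\mathbb{N}$ and $C>0$ such that for every such problem and every $\varepsilon>0$, NoCK with $T=\max\{0,\lceil\log_2(D_H/\varepsilon)\rceil\}$ has the following properties. (1) Every stage $t<T$, from whatever point $x_t$, satisfies $\mathbb{E}[H_t(x_{t+1})-\inf H_t\mid x_t]\le\frac14(H_t(x_t)-\inf H_t)$. (2) $x_T$ is a stochastic $\varepsilon$-solution: $\mathbb{E}[H(x_T)-H(x^*)]\le\varepsilon$. (3) If $D_H\ge 2\varepsilon$, then for every outcome of the sampling the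 total number of evaluations of component maps $G_j$, component Jacobians $\nabla G_j$, component gradients $\nabla F_i$ and proximal mappings is at most $$C\left((n_1+n_2)\log\frac{D_H}{\varepsilon}+\frac{D_x^{2.5}\sqrt L\,\max\{B_G^4L_F^2,\,B_F^2L_G^2\}}{\varepsilon^{2.5}}+\frac{\sqrt{D_xL}\;n_1}{\sqrt\varepsilon}\right).$$ -/

import Mathlib

noncomputable section

namespace CompOpt

/-! ### Randomised computations with a count of oracle calls -/

/-- A randomised computation that carries a counter of the oracle calls made so far. -/
abbrev Comp (α : Type) : Type := StateT ℕ PMF α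

/-- Return the answer `a` of an oracle call, at the price of one unit. -/
def Comp.ask {α : Type} (a : α) : Comp α := do
  modify (fun c => c + 1)
  pure a

/-- Draw an element of a finite type uniformly at random (independently of everything before). -/
def Comp.sample (α : Type) [Fintype α] [Nonempty α] : Comp α :=
  StateT.lift (PMF.uniformOfFintype α)

/-- Run `n` computations one after the other and collect the results. -/
def Comp.forAll {α : Type} : (n : ℕ) → (Fin n → Comp α) → Comp (Fin n → α)
  | 0, _ => pure Fin.elim0
  | n + 1, f => do
    let a ← f 0
    let r ← Comp.forAll n (fun i => f i.succ)
    pure (Fin.cons a r)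

/-- The joint law of the result and of the number of oracle calls. -/
def Comp.outcome {α : Type} (c : Comp α) : PMF (α × ℕ) := StateT.run c 0

/-- The law of the result. -/
def Comp.law {α : Type} (c : Comp α) : PMF α := c.outcome.map Prod.fst

/-- Expectation of a `[0,∞]`-valued function under a discrete law. -/
def expect {α : Type} (p : PMF α) (φ : α → ENNReal) : ENNReal := ∑' a, p a * φ a

/-! ### The problem -/

/-- Euclidean space `ℝ^N`. -/
abbrev Vec (N : ℕ) : Type := EuclideanSpace ℝ (Fin N)

/-- The data of `min_x (1/n₁) ∑ᵢ Fᵢ ((1/n₂) ∑ⱼ Gⱼ x) + h x`; `h` may take the value `+∞`. -/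
structure Problem (N₁ N₂ n₁ n₂ : ℕ) where
  F : Fin n₁ → Vec N₁ → ℝ
  G : Fin n₂ → Vec N₂ → Vec N₁
  h : Vec N₂ → EReal

namespace Problem

variable {N₁ N₂ n₁ n₂ : ℕ}

/-- The average `F` of the outer functions. -/
def outer (P : Problem N₁ N₂ n₁ n₂) (u : Vec N₁) : ℝ := (1 / (n₁ : ℝ)) * ∑ i, P.F i u

/-- The average `G` of the inner maps. -/
def inner (P : Problem N₁ N₂ n₁ n₂) (x : Vec N₂) : Vec N₁ := (1 / (n₂ : ℝ)) • ∑ j, P.G j x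

/-- The smooth part `f = F ∘ G`. -/
def f (P : Problem N₁ N₂ n₁ n₂) (x : Vec N₂) : ℝ := P.outer (P.inner x)

/-- The objective `H = f + h`. -/
def H (P : Problem N₁ N₂ n₁ n₂) (x : Vec N₂) : EReal := (P.f x : EReal) + P.h x

/-- The optimal value of `H`. -/
def optVal (P : Problem N₁ N₂ n₁ n₂) : EReal := ⨅ x, P.H x

/-- The optimality gap `H x - inf H ∈ [0,∞]`. -/
def gap (P : Problem N₁ N₂ n₁ n₂) (x : Vec N₂) : ENNReal := (P.H x - P.optVal).toENNReal

/-- The problem with `h` replaced by `h + (μ/2) ‖· - x₀‖²`. -/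
def regularize (P : Problem N₁ N₂ n₁ n₂) (μ : ℝ) (x₀ : Vec N₂) : Problem N₁ N₂ n₁ n₂ where
  F := P.F
  G := P.G
  h := fun x => P.h x + ((μ / 2 * ‖x - x₀‖ ^ 2 : ℝ) : EReal)

/-- A random vector with law `p` is a stochastic `ε`-solution: the expected gap is at most `ε`. -/
def IsStochasticSol (P : Problem N₁ N₂ n₁ n₂) (ε : ℝ) (p : PMF (Vec N₂)) : Prop :=
  expect p P.gap ≤ ENNReal.ofReal ε

/-- `f` is convex and `h` is a proper closed convex function (with convex epigraph). -/
structure IsConvex (P : Problem N₁ N₂ n₁ n₂) : Prop where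
  f_convex : ConvexOn ℝ Set.univ P.f
  h_convex : Convex ℝ {p : Vec N₂ × ℝ | P.h p.1 ≤ (p.2 : EReal)}
  h_closed : LowerSemicontinuous P.h
  h_ne_bot : ∀ x, P.h x ≠ ⊥
  h_proper : ∃ x, P.h x ≠ ⊤

/-- Each `Fᵢ` is `L_F`-smooth with `B_F`-bounded gradient, and each `Gⱼ` is `L_G`-smooth with
`B_G`-bounded Jacobian (in the spectral norm). -/
structure SmoothBounded (P : Problem N₁ N₂ n₁ n₂) (L_F B_F L_G B_G : ℝ) : Prop where
  L_F_nonneg : 0 ≤ L_F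
  L_G_nonneg : 0 ≤ L_G
  F_diff : ∀ i, Differentiable ℝ (P.F i)
  F_smooth : ∀ i u v, ‖gradient (P.F i) u - gradient (P.F i) v‖ ≤ L_F * ‖u - v‖
  F_bound : ∀ i u, ‖gradient (P.F i) u‖ ≤ B_F
  G_diff : ∀ j, Differentiable ℝ (P.G j)
  G_smooth : ∀ j x y, ‖fderiv ℝ (P.G j) x - fderiv ℝ (P.G j) y‖ ≤ L_G * ‖x - y‖
  G_bound : ∀ j x, ‖fderiv ℝ (P.G j) x‖ ≤ B_G

/-- `x ↦ [∇Gⱼ(x)]ᵀ ∇Fᵢ(G(x))` is `L`-Lipschitz for all `i` and `j`. -/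
def JointSmooth (P : Problem N₁ N₂ n₁ n₂) (L : ℝ) : Prop :=
  ∀ i j x y,
    ‖(fderiv ℝ (P.G j) x).adjoint (gradient (P.F i) (P.inner x))
      - (fderiv ℝ (P.G j) y).adjoint (gradient (P.F i) (P.inner y))‖ ≤ L * ‖x - y‖

/-! ### The oracles: each call counts one -/

/-- Evaluation of the component map `Gⱼ`. -/
def askG (P : Problem N₁ N₂ n₁ n₂) (j : Fin n₂) (x : Vec N₂) : Comp (Vec N₁) :=
  Comp.ask (P.G j x)

/-- Evaluation of the component Jacobian `∇Gⱼ`. -/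
def askJac (P : Problem N₁ N₂ n₁ n₂) (j : Fin n₂) (x : Vec N₂) : Comp (Vec N₂ →L[ℝ] Vec N₁) :=
  Comp.ask (fderiv ℝ (P.G j) x)

/-- Evaluation of the component gradient `∇Fᵢ`. -/
def askGrad (P : Problem N₁ N₂ n₁ n₂) (i : Fin n₁) (u : Vec N₁) : Comp (Vec N₁) :=
  Comp.ask (gradient (P.F i) u)

/-- A minimiser over `w` of `⟨d, w⟩ + (c/2) ‖w - u‖² + h w`. -/
def prox (P : Problem N₁ N₂ n₁ n₂) (d : Vec N₂) (c : ℝ) (u : Vec N₂) : Vec N₂ :=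
  Classical.epsilon fun z => ∀ w,
    ((Inner.inner ℝ d z + c / 2 * ‖z - u‖ ^ 2 : ℝ) : EReal) + P.h z
      ≤ ((Inner.inner ℝ d w + c / 2 * ‖w - u‖ ^ 2 : ℝ) : EReal) + P.h w

/-- Evaluation of the proximal mapping. -/
def askProx (P : Problem N₁ N₂ n₁ n₂) (d : Vec N₂) (c : ℝ) (u : Vec N₂) : Comp (Vec N₂) :=
  Comp.ask (P.prox d c u)

end Problem

/-! ### SoCK, with the full outer gradient (Option I) -/

/-- Parameters of SoCK other than the number of outer loops. -/
structure Params where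
  L : ℝ
  m : ℕ
  τ₁ : ℝ
  τ₂ : ℝ
  θ : ℝ
  α : ℝ
  A : ℕ
  B : ℕ

/-- The parameter choice for strong-convexity modulus `μ`; the batch sizes are rounded up to
positive integers. -/
def sockParams (L L_F B_F L_G B_G μ : ℝ) : Params :=
  let m : ℕ := ⌈1 / 2 * √(L / μ)⌉₊
  let τ : ℝ := 1 / (2 * (m : ℝ))
  { L := L
    m := m
    τ₁ := τ
    τ₂ := τ
    θ := 1 + 1 / (12 * (m : ℝ))
    α := 1 / (3 * τ * L)
    A := max 1 ⌈720 * B_G ^ 4 * L_F ^ 2 / μ ^ 2⌉₊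
    B := max 1 ⌈720 * B_F ^ 2 * L_G ^ 2 / μ ^ 2⌉₊ }

section Algorithms

variable {N₁ N₂ n₁ n₂ : ℕ} [NeZero n₂]

/-- One inner iteration of SoCK with snapshot `xs`, `Gs = G(xs)`, `Js = ∇G(xs)`; it maps
`(z_k, y_k)` to `(z_{k+1}, y_{k+1})`. -/
def sockStep (P : Problem N₁ N₂ n₁ n₂) (q : Params) (xs : Vec N₂) (Gs : Vec N₁)
    (Js : Vec N₂ →L[ℝ] Vec N₁) (z y : Vec N₂) : Comp (Vec N₂ × Vec N₂) := do
  let x : Vec N₂ := q.τ₁ • z + q.τ₂ • xs + (1 - q.τ₁ - q.τ₂) • y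
  let a ← Comp.sample (Fin q.A → Fin n₂)
  let b ← Comp.sample (Fin q.B → Fin n₂)
  let gx ← Comp.forAll q.A (fun i => P.askG (a i) x)
  let gs ← Comp.forAll q.A (fun i => P.askG (a i) xs)
  let Jx ← Comp.forAll q.B (fun i => P.askJac (b i) x)
  let Js' ← Comp.forAll q.B (fun i => P.askJac (b i) xs)
  let Ghat : Vec N₁ := (1 / (q.A : ℝ)) • ∑ i, (gx i - gs i) + Gs
  let Jhat : Vec N₂ →L[ℝ] Vec N₁ := (1 / (q.B : ℝ)) • ∑ i, (Jx i - Js' i) + Js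
  let gF ← Comp.forAll n₁ (fun i => P.askGrad i Ghat)
  let d : Vec N₂ := Jhat.adjoint ((1 / (n₁ : ℝ)) • ∑ i, gF i)
  let z' ← P.askProx d (1 / q.α) z
  let y' ← P.askProx d (3 * q.L) x
  pure (z', y')

/-- The first `j` inner iterations, started at `(z, y)`; the third component of the result is
`∑_{i<j} θ^i y_{i+1}`. -/
def sockInner (P : Problem N₁ N₂ n₁ n₂) (q : Params) (xs : Vec N₂) (Gs : Vec N₁)
    (Js : Vec N₂ →L[ℝ] Vec N₁) (z y : Vec N₂) : ℕ → Comp (Vec N₂ × Vec N₂ × Vec N₂)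
  | 0 => pure (z, y, 0)
  | j + 1 => do
    let r ← sockInner P q xs Gs Js z y j
    let r' ← sockStep P q xs Gs Js r.1 r.2.1
    pure (r'.1, r'.2, r.2.2 + q.θ ^ j • r'.2)

/-- The first `s` outer loops of SoCK, started at `x₀`; the result is `(x̃^s, z_{sm}, y_{sm})`. -/
def sockOuter (P : Problem N₁ N₂ n₁ n₂) (q : Params) (x₀ : Vec N₂) :
    ℕ → Comp (Vec N₂ × Vec N₂ × Vec N₂)
  | 0 => pure (x₀, x₀, x₀)
  | s + 1 => do
    let r ← sockOuter P q x₀ s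
    let xs : Vec N₂ := r.1
    let g ← Comp.forAll n₂ (fun j => P.askG j xs)
    let J ← Comp.forAll n₂ (fun j => P.askJac j xs)
    let Gs : Vec N₁ := (1 / (n₂ : ℝ)) • ∑ j, g j
    let Js : Vec N₂ →L[ℝ] Vec N₁ := (1 / (n₂ : ℝ)) • ∑ j, J j
    -- the gradients that enter the full gradient of the smooth part at the snapshot
    let _gF ← Comp.forAll n₁ (fun i => P.askGrad i Gs)
    let w ← sockInner P q xs Gs Js r.2.1 r.2.2 q.m
    pure ((∑ j ∈ Finset.range q.m, q.θ ^ j)⁻¹ • w.2.2, w.1, w.2.1)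

/-- SoCK with `S` outer loops: returns the last snapshot. -/
def sock (P : Problem N₁ N₂ n₁ n₂) (q : Params) (S : ℕ) (x₀ : Vec N₂) : Comp (Vec N₂) := do
  let r ← sockOuter P q x₀ S
  pure r.1

/-! ### NoCK -/

/-- The stage-`t` problem: objective `H + (μ_t/2) ‖· - x₀‖²` with `μ_t = μ₀ / 2^t`. -/
def nockProblem (P : Problem N₁ N₂ n₁ n₂) (μ₀ : ℝ) (x₀ : Vec N₂) (t : ℕ) :
    Problem N₁ N₂ n₁ n₂ :=
  P.regularize (μ₀ / 2 ^ t) x₀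

/-- Stage `t` of NoCK from the point `x`: SoCK with `S` outer loops on the stage-`t` problem. -/
def nockStage (P : Problem N₁ N₂ n₁ n₂) (L L_F B_F L_G B_G : ℝ) (S : ℕ) (μ₀ : ℝ) (x₀ : Vec N₂)
    (t : ℕ) (x : Vec N₂) : Comp (Vec N₂) :=
  sock (nockProblem P μ₀ x₀ t) (sockParams L L_F B_F L_G B_G (μ₀ / 2 ^ t)) S x

/-- The first `T` stages of NoCK; returns `x_T`. -/
def nock (P : Problem N₁ N₂ n₁ n₂) (L L_F B_F L_G B_G : ℝ) (S : ℕ) (μ₀ : ℝ) (x₀ : Vec N₂) :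
    ℕ → Comp (Vec N₂)
  | 0 => pure x₀
  | t + 1 => do
    let x ← nock P L L_F B_F L_G B_G S μ₀ x₀ t
    nockStage P L L_F B_F L_G B_G S μ₀ x₀ t x

end Algorithms

end CompOpt

end

open scoped RealInnerProductSpace BigOperators

namespace CompOpt

/-! ### Expectations and costs of randomised computations -/

/-! One inner iteration is an accelerated proximal step with a biased gradient estimate `d`:
sampling takes place inside `∇F`, so the term `τ⟪d - ∇f(x), u - z⟫` has no zero mean. Young's
inequality charges it partly to the strong convexity of `φ` and partly to `‖d - ∇f(x)‖²`
(`step_inequality`, `step_inequality_error`). The mean square error is at most a multiple of `‖x -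
xs‖²`, of size `μ²/180` for the chosen batches (`expect_norm_estGrad_sub_sq_le`). Distances to the
snapshot are bounded by distances to the minimiser `u`, and quadratic growth turns those of `xs` and
`y` into gaps. The error thus costs only `τ/20` of the gaps at `xs` and `y`, plus a small multiple
of `‖z - u‖²` (`expect_step_le`).

Weighting the iterations by `θ^j` makes these inequalities telescope over an inner loop. Convexity
of the gap passes to the weighted average, and a potential made of the gaps at `x̃` and `y` and of
`‖z - u‖²` shrinks by `12/13` per outer loop (`mean_sockInner_le`, `outerPot_le`). It starts below
ten times its own snapshot term, and `10 * (12/13)^64 ≤ 1/12`; hence `S = 64` and the contraction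
`1/12` of each stage (`mean_sock_gap_le`).

Halving `μ` raises the regularised gap by at most `μ D_x/4`, so by induction the gap of `x_t` in
stage `t` is at most `D_H/2^t` in expectation. For the last output, the estimate `H(x) - H(x*) ≤ μ
D_x/3 + 2 (H_μ(x) - min H_μ)` together with the factor `1/12` gives exactly half of `D_H/2^(T-1)`.
This is where a contraction stronger than `1/4` is needed.

The number of calls is deterministic. Apart from the full passes, the stage costs are dominated by
quantities that grow geometrically in `t`, so their sum is controlled by the last stage, where `1/μ
≤ D_x/ε`. Expectations take values in `[0,∞]`, so no integrability has to be checked and points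
outside the domain have gap `⊤`. -/

theorem expect_pure {α : Type} (a : α) (φ : α → ENNReal) : expect (PMF.pure a) φ = φ a := by
  unfold expect
  rw [tsum_eq_single a]
  · simp
  · intro b hb
    simp [PMF.pure_apply, hb]

theorem expect_bind {α β : Type} (p : PMF α) (k : α → PMF β) (φ : β → ENNReal) :
    expect (p.bind k) φ = expect p (fun a => expect (k a) φ) := by
  unfold expect
  simp only [PMF.bind_apply, ← ENNReal.tsum_mul_right, ← ENNReal.tsum_mul_left]
  rw [ENNReal.tsum_comm]
  simp only [mul_assoc]

theorem expect_map {α β : Type} (p : PMF α) (g : α → β) (φ : β → ENNReal) :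
    expect (p.map g) φ = expect p (fun a => φ (g a)) := by
  simp only [PMF.map, expect_bind, Function.comp_def, expect_pure]

theorem expect_mono {α : Type} (p : PMF α) {φ ψ : α → ENNReal} (h : ∀ a, φ a ≤ ψ a) :
    expect p φ ≤ expect p ψ :=
  ENNReal.tsum_le_tsum fun a => mul_le_mul_right (h a) _

theorem expect_const_add {α : Type} (p : PMF α) (c : ENNReal) (φ : α → ENNReal) :
    expect p (fun a => c + φ a) = c + expect p φ := by
  unfold expect
  simp only [mul_add]
  rw [ENNReal.tsum_add, ENNReal.tsum_mul_right, p.tsum_coe, one_mul]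

theorem expect_const_mul {α : Type} (p : PMF α) (c : ENNReal) (φ : α → ENNReal) :
    expect p (fun a => c * φ a) = c * expect p φ := by
  unfold expect
  rw [← ENNReal.tsum_mul_left]
  exact tsum_congr fun a => mul_left_comm _ _ _

/-- The bridge to real finite averages, in which the variance computations are done. -/
theorem expect_uniform_ofReal {α : Type} [Fintype α] [Nonempty α] (φ : α → ℝ)
    (hφ : ∀ a, 0 ≤ φ a) :
    expect (PMF.uniformOfFintype α) (fun a => ENNReal.ofReal (φ a))
      = ENNReal.ofReal (Finset.univ.expect φ) := by
  unfold expect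
  rw [tsum_fintype, Finset.expect_eq_sum_div_card, div_eq_inv_mul,
    ENNReal.ofReal_mul (by positivity), ENNReal.ofReal_sum_of_nonneg (fun a _ => hφ a),
    ENNReal.ofReal_inv_of_pos (by simp [Fintype.card_pos]), Finset.mul_sum]
  simp [PMF.uniformOfFintype_apply]

/-- Expectation of `φ` of the result of a computation started with counter `s`. -/
noncomputable def Comp.mean {α : Type} (c : Comp α) (φ : α → ENNReal) (s : ℕ) : ENNReal :=
  expect (StateT.run c s) (fun r => φ r.1)

theorem Comp.run_bind {α β : Type} (c : Comp α) (k : α → Comp β) (s : ℕ) :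
    StateT.run (c >>= k) s = (StateT.run c s).bind (fun r => StateT.run (k r.1) r.2) := rfl

theorem Comp.run_pure {α : Type} (a : α) (s : ℕ) :
    StateT.run (pure a : Comp α) s = PMF.pure (a, s) := rfl

theorem Comp.run_ask {α : Type} (a : α) (s : ℕ) :
    StateT.run (Comp.ask a) s = PMF.pure (a, s + 1) := by
  have : StateT.run (Comp.ask a) s
      = (PMF.pure ((), s + 1)).bind (fun r => PMF.pure (a, r.2)) := rfl
  rw [this, PMF.pure_bind]

theorem Comp.run_sample {α : Type} [Fintype α] [Nonempty α] (s : ℕ) :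
    StateT.run (Comp.sample α) s = (PMF.uniformOfFintype α).bind (fun a => PMF.pure (a, s)) := rfl

/-- Oracle answers are deterministic, so a batch of queries only shifts the counter. -/
theorem Comp.run_forAll_ask {α : Type} (n : ℕ) (v : Fin n → α) (s : ℕ) :
    StateT.run (Comp.forAll n (fun i => Comp.ask (v i))) s = PMF.pure (v, s + n) := by
  induction n generalizing s with
  | zero =>
    rw [Comp.forAll, Comp.run_pure]
    congr 2
    exact Subsingleton.elim _ _
  | succ n ih =>
    rw [Comp.forAll, Comp.run_bind, Comp.run_ask, PMF.pure_bind, Comp.run_bind, ih,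
      PMF.pure_bind, Comp.run_pure]
    congr 2
    · funext i
      refine Fin.cases ?_ (fun i => ?_) i <;> simp
    · simp only
      omega

theorem Comp.mean_pure {α : Type} (a : α) (φ : α → ENNReal) (s : ℕ) :
    Comp.mean (pure a) φ s = φ a := by
  rw [Comp.mean, Comp.run_pure, expect_pure]

theorem Comp.mean_bind {α β : Type} (c : Comp α) (k : α → Comp β) (φ : β → ENNReal) (s : ℕ) :
    (c >>= k).mean φ s = expect (StateT.run c s) (fun r => (k r.1).mean φ r.2) := by
  rw [Comp.mean, Comp.run_bind, expect_bind]
  rfl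

/-- The tower property as an inequality. The hypothesis ranges over all counters because the
continuation starts from whatever count the first computation has reached. -/
theorem Comp.mean_bind_le {α β : Type} (c : Comp α) (k : α → Comp β) (φ : β → ENNReal)
    (ψ : α → ENNReal) (h : ∀ a s, (k a).mean φ s ≤ ψ a) (s : ℕ) :
    (c >>= k).mean φ s ≤ c.mean ψ s := by
  rw [Comp.mean_bind]
  exact expect_mono _ fun r => h r.1 r.2

theorem Comp.mean_mono {α : Type} (c : Comp α) {φ ψ : α → ENNReal} (h : ∀ a, φ a ≤ ψ a) (s : ℕ) :
    c.mean φ s ≤ c.mean ψ s :=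
  expect_mono _ fun r => h r.1

theorem Comp.mean_const_add {α : Type} (c : Comp α) (b : ENNReal) (φ : α → ENNReal) (s : ℕ) :
    c.mean (fun a => b + φ a) s = b + c.mean φ s :=
  expect_const_add _ b _

theorem Comp.mean_const_mul {α : Type} (c : Comp α) (b : ENNReal) (φ : α → ENNReal) (s : ℕ) :
    c.mean (fun a => b * φ a) s = b * c.mean φ s :=
  expect_const_mul _ b _

theorem Comp.expect_law {α : Type} (c : Comp α) (φ : α → ENNReal) :
    expect c.law φ = c.mean φ 0 :=
  expect_map _ _ _

/-- The computation makes exactly `N` oracle calls, in every outcome. -/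
noncomputable def Comp.HasCost {α : Type} (c : Comp α) (N : ℕ) : Prop :=
  ∀ s, ∀ r ∈ (StateT.run c s).support, r.2 = s + N

theorem Comp.HasCost.pure {α : Type} (a : α) : Comp.HasCost (pure a : Comp α) 0 := by
  intro s r hr
  rw [Comp.run_pure, PMF.mem_support_pure_iff] at hr
  simp [hr]

theorem Comp.HasCost.bind {α β : Type} {c : Comp α} {k : α → Comp β} {M N : ℕ}
    (hc : c.HasCost M) (hk : ∀ a, (k a).HasCost N) : (c >>= k).HasCost (M + N) := by
  intro s r hr
  rw [Comp.run_bind, PMF.mem_support_bind_iff] at hr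
  obtain ⟨r', h1, h2⟩ := hr
  rw [hk _ _ _ h2, hc _ _ h1, add_assoc]

theorem Comp.HasCost.ask {α : Type} (a : α) : (Comp.ask a).HasCost 1 := by
  intro s r hr
  rw [Comp.run_ask, PMF.mem_support_pure_iff] at hr
  simp [hr]

theorem Comp.HasCost.sample {α : Type} [Fintype α] [Nonempty α] :
    (Comp.sample α).HasCost 0 := by
  intro s r hr
  rw [Comp.run_sample, PMF.mem_support_bind_iff] at hr
  obtain ⟨a, -, h2⟩ := hr
  rw [PMF.mem_support_pure_iff] at h2
  simp [h2]

theorem Comp.HasCost.forAll_ask {α : Type} (n : ℕ) (v : Fin n → α) :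
    (Comp.forAll n (fun i => Comp.ask (v i))).HasCost n := by
  intro s r hr
  rw [Comp.run_forAll_ask, PMF.mem_support_pure_iff] at hr
  simp [hr]

section

variable {N₁ N₂ n₁ n₂ : ℕ} [NeZero n₂]

/-! ### The laws of the steps of the algorithms -/

/-- The point at which one inner iteration queries the oracles. -/
noncomputable def queryPoint (q : Params) (xs z y : Vec N₂) : Vec N₂ :=
  q.τ₁ • z + q.τ₂ • xs + (1 - q.τ₁ - q.τ₂) • y

/-- The estimate of `G x` from the batch `a`. -/
noncomputable def estG (P : Problem N₁ N₂ n₁ n₂) {A : ℕ} (xs x : Vec N₂)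
    (a : Fin A → Fin n₂) : Vec N₁ :=
  (1 / (A : ℝ)) • ∑ i, (P.G (a i) x - P.G (a i) xs) + P.inner xs

/-- The average of the component Jacobians. -/
noncomputable def Problem.jac (P : Problem N₁ N₂ n₁ n₂) (x : Vec N₂) : Vec N₂ →L[ℝ] Vec N₁ :=
  (1 / (n₂ : ℝ)) • ∑ j, fderiv ℝ (P.G j) x

/-- The average of the component gradients of the outer functions. -/
noncomputable def Problem.outerGrad (P : Problem N₁ N₂ n₁ n₂) (u : Vec N₁) : Vec N₁ :=
  (1 / (n₁ : ℝ)) • ∑ i, gradient (P.F i) u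

/-- The estimate of the Jacobian at `x` from the batch `b`. -/
noncomputable def estJac (P : Problem N₁ N₂ n₁ n₂) {B : ℕ} (xs x : Vec N₂) (b : Fin B → Fin n₂) :
    Vec N₂ →L[ℝ] Vec N₁ :=
  (1 / (B : ℝ)) • ∑ i, (fderiv ℝ (P.G (b i)) x - fderiv ℝ (P.G (b i)) xs) + P.jac xs

/-- The estimate of the gradient of `f` at `x` from the batches `a` and `b`. -/
noncomputable def estGrad (P : Problem N₁ N₂ n₁ n₂) {A B : ℕ} (xs x : Vec N₂) (a : Fin A → Fin n₂)
    (b : Fin B → Fin n₂) : Vec N₂ :=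
  (estJac P xs x b).adjoint (P.outerGrad (estG P xs x a))

theorem run_sockStep (P : Problem N₁ N₂ n₁ n₂) (q : Params) (xs z y : Vec N₂) (s : ℕ) :
    StateT.run (sockStep P q xs (P.inner xs) (P.jac xs) z y) s
      = (PMF.uniformOfFintype (Fin q.A → Fin n₂)).bind fun a =>
          (PMF.uniformOfFintype (Fin q.B → Fin n₂)).bind fun b =>
            PMF.pure ((P.prox (estGrad P xs (queryPoint q xs z y) a b) (1 / q.α) z,
              P.prox (estGrad P xs (queryPoint q xs z y) a b) (3 * q.L) (queryPoint q xs z y)),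
              s + q.A + q.A + q.B + q.B + n₁ + 1 + 1) := by
  unfold sockStep
  simp only [Comp.run_bind, Comp.run_sample, PMF.bind_bind, PMF.pure_bind, Problem.askG,
    Problem.askJac, Problem.askGrad, Problem.askProx, Comp.run_forAll_ask, Comp.run_ask,
    Comp.run_pure]
  rfl

theorem mean_sockStep (P : Problem N₁ N₂ n₁ n₂) (q : Params) (xs z y : Vec N₂)
    (φ : Vec N₂ × Vec N₂ → ENNReal) (s : ℕ) :
    (sockStep P q xs (P.inner xs) (P.jac xs) z y).mean φ s
      = expect (PMF.uniformOfFintype (Fin q.A → Fin n₂)) fun a =>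
          expect (PMF.uniformOfFintype (Fin q.B → Fin n₂)) fun b =>
            φ (P.prox (estGrad P xs (queryPoint q xs z y) a b) (1 / q.α) z,
              P.prox (estGrad P xs (queryPoint q xs z y) a b) (3 * q.L)
                (queryPoint q xs z y)) := by
  simp only [Comp.mean, run_sockStep, expect_bind, expect_pure]

/-- Batch sizes are fixed in advance, so the count does not depend on the sampling: each sampled
index is queried at both `x` and the snapshot, then there is one pass over the `∇Fᵢ` and two
proximal steps. -/
theorem hasCost_sockStep (P : Problem N₁ N₂ n₁ n₂) (q : Params) (xs : Vec N₂) (Gs : Vec N₁)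
    (Js : Vec N₂ →L[ℝ] Vec N₁) (z y : Vec N₂) :
    (sockStep P q xs Gs Js z y).HasCost (2 * q.A + 2 * q.B + n₁ + 2) := by
  have h : (sockStep P q xs Gs Js z y).HasCost
      (0 + (0 + (q.A + (q.A + (q.B + (q.B + (n₁ + (1 + (1 + 0))))))))) :=
    .bind .sample fun a => .bind .sample fun b => .bind (.forAll_ask _ _) fun gx =>
      .bind (.forAll_ask _ _) fun gs => .bind (.forAll_ask _ _) fun Jx =>
      .bind (.forAll_ask _ _) fun Js => .bind (.forAll_ask _ _) fun gF =>
      .bind (.ask _) fun z' => .bind (.ask _) fun y' => .pure _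
  convert h using 1
  ring

theorem hasCost_sockInner (P : Problem N₁ N₂ n₁ n₂) (q : Params) (xs : Vec N₂) (Gs : Vec N₁)
    (Js : Vec N₂ →L[ℝ] Vec N₁) (z y : Vec N₂) (j : ℕ) :
    (sockInner P q xs Gs Js z y j).HasCost (j * (2 * q.A + 2 * q.B + n₁ + 2)) := by
  induction j with
  | zero =>
    rw [Nat.zero_mul]
    exact .pure _
  | succ j ih =>
    have h : (sockInner P q xs Gs Js z y (j + 1)).HasCost _ :=
      .bind ih fun r => .bind (hasCost_sockStep P q xs Gs Js r.1 r.2.1) fun r' => .pure _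
    convert h using 1
    ring

theorem hasCost_sockOuter (P : Problem N₁ N₂ n₁ n₂) (q : Params) (x₀ : Vec N₂) (s : ℕ) :
    (sockOuter P q x₀ s).HasCost
      (s * (2 * n₂ + n₁ + q.m * (2 * q.A + 2 * q.B + n₁ + 2))) := by
  induction s with
  | zero =>
    rw [Nat.zero_mul]
    exact .pure _
  | succ s ih =>
    have h : (sockOuter P q x₀ (s + 1)).HasCost _ :=
      .bind ih fun r => .bind (.forAll_ask _ _) fun g => .bind (.forAll_ask _ _) fun J =>
        .bind (.forAll_ask _ _) fun gF => .bind (hasCost_sockInner P q r.1 _ _ _ _ _) fun w =>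
        .pure _
    convert h using 1
    ring

theorem hasCost_sock (P : Problem N₁ N₂ n₁ n₂) (q : Params) (S : ℕ) (x₀ : Vec N₂) :
    (sock P q S x₀).HasCost
      (S * (2 * n₂ + n₁ + q.m * (2 * q.A + 2 * q.B + n₁ + 2))) :=
  .bind (hasCost_sockOuter P q x₀ S) fun _ => .pure _

theorem hasCost_nock (P : Problem N₁ N₂ n₁ n₂) (L L_F B_F L_G B_G : ℝ) (S : ℕ) (μ₀ : ℝ)
    (x₀ : Vec N₂) (c : ℕ → ℕ)
    (hc : ∀ t, c t = S * (2 * n₂ + n₁ + (sockParams L L_F B_F L_G B_G (μ₀ / 2 ^ t)).m *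
      (2 * (sockParams L L_F B_F L_G B_G (μ₀ / 2 ^ t)).A
        + 2 * (sockParams L L_F B_F L_G B_G (μ₀ / 2 ^ t)).B + n₁ + 2))) (T : ℕ) :
    (nock P L L_F B_F L_G B_G S μ₀ x₀ T).HasCost (∑ t ∈ Finset.range T, c t) := by
  induction T with
  | zero => exact .pure _
  | succ T ih =>
    rw [Finset.sum_range_succ, hc T]
    exact .bind ih fun x => hasCost_sock _ _ _ _

theorem mean_sockInner_succ_le (P : Problem N₁ N₂ n₁ n₂) (q : Params) (xs : Vec N₂) (Gs : Vec N₁)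
    (Js : Vec N₂ →L[ℝ] Vec N₁) (z y : Vec N₂) (j : ℕ)
    (φ ψ : Vec N₂ × Vec N₂ × Vec N₂ → ENNReal)
    (h : ∀ r s, (sockStep P q xs Gs Js r.1 r.2.1).mean
      (fun r' => φ (r'.1, r'.2, r.2.2 + q.θ ^ j • r'.2)) s ≤ ψ r) (s : ℕ) :
    (sockInner P q xs Gs Js z y (j + 1)).mean φ s
      ≤ (sockInner P q xs Gs Js z y j).mean ψ s := by
  refine Comp.mean_bind_le _ _ _ _ (fun r s => ?_) s
  refine le_trans (Comp.mean_bind_le _ _ _ _ (fun r' s => ?_) s) (h r s)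
  exact (Comp.mean_pure _ _ _).le

/-- The full passes at the snapshot return exactly its `P.inner` and `P.jac`, so the analysis of the
inner loop only needs these values. -/
theorem mean_sockOuter_succ_le (P : Problem N₁ N₂ n₁ n₂) (q : Params) (x₀ : Vec N₂) (k : ℕ)
    (φ ψ : Vec N₂ × Vec N₂ × Vec N₂ → ENNReal)
    (h : ∀ r s, (sockInner P q r.1 (P.inner r.1) (P.jac r.1) r.2.1 r.2.2 q.m).mean
      (fun w => φ ((∑ j ∈ Finset.range q.m, q.θ ^ j)⁻¹ • w.2.2, w.1, w.2.1)) s ≤ ψ r) (s : ℕ) :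
    (sockOuter P q x₀ (k + 1)).mean φ s ≤ (sockOuter P q x₀ k).mean ψ s := by
  refine Comp.mean_bind_le _ _ _ _ (fun r s => ?_) s
  simp only [Problem.askG, Problem.askJac, Problem.askGrad]
  simp only [Comp.mean_bind, Comp.run_forAll_ask, expect_pure, Comp.mean_pure]
  exact h r _

theorem mean_sock_le (P : Problem N₁ N₂ n₁ n₂) (q : Params) (S : ℕ) (x₀ : Vec N₂)
    (φ : Vec N₂ → ENNReal) (s : ℕ) :
    (sock P q S x₀).mean φ s ≤ (sockOuter P q x₀ S).mean (fun r => φ r.1) s :=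
  Comp.mean_bind_le _ _ _ _ (fun _ _ => (Comp.mean_pure _ _ _).le) s

end

/-! ### Convex analysis -/

section

variable {E : Type*} [NormedAddCommGroup E] [InnerProductSpace ℝ E]

theorem norm_combo_sub_sq (x y u : E) {a b : ℝ} (hab : a + b = 1) :
    ‖a • x + b • y - u‖ ^ 2 = a * ‖x - u‖ ^ 2 + b * ‖y - u‖ ^ 2 - a * b * ‖x - y‖ ^ 2 := by
  have h1 : a • x + b • y - u = a • (x - u) + b • (y - u) := by
    have : u = (a + b) • u := by rw [hab, one_smul]
    nth_rewrite 1 [this]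
    module
  have h2 : x - y = (x - u) - (y - u) := by abel
  rw [h1, h2]
  generalize x - u = p
  generalize y - u = q
  rw [norm_add_sq_real, norm_sub_sq_real, norm_smul, norm_smul, mul_pow, mul_pow,
    real_inner_smul_left, real_inner_smul_right, Real.norm_eq_abs, Real.norm_eq_abs, sq_abs,
    sq_abs]
  obtain rfl : b = 1 - a := by linarith
  ring

theorem norm_three_combo_sub_sq_le (z xs y : E) {τ : ℝ} (h0 : 0 ≤ τ) (h1 : τ ≤ 1 / 2) :
    ‖τ • z + τ • xs + (1 - τ - τ) • y - xs‖ ^ 2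
      ≤ τ * ‖z - xs‖ ^ 2 + (1 - 2 * τ) * ‖y - xs‖ ^ 2 := by
  have h : τ • z + τ • xs + (1 - τ - τ) • y - xs
      = τ • (z - xs) + (1 - 2 * τ) • (y - xs) := by module
  rw [h, norm_add_sq_real, norm_smul, norm_smul, mul_pow, mul_pow,
    real_inner_smul_left, real_inner_smul_right, Real.norm_eq_abs, Real.norm_eq_abs, sq_abs,
    sq_abs]
  have h3 := real_inner_le_norm (z - xs) (y - xs)
  have h4 : 0 ≤ τ * (1 - 2 * τ) := mul_nonneg h0 (by linarith)
  have h5 := mul_le_mul_of_nonneg_left h3 h4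
  have h6 := mul_nonneg h4 (sq_nonneg (‖z - xs‖ - ‖y - xs‖))
  have h7 : 0 ≤ τ * τ * ‖z - xs‖ ^ 2 := by positivity
  have h8 : 0 ≤ (1 - 2 * τ) * τ * ‖y - xs‖ ^ 2 := by
    have : 0 ≤ 1 - 2 * τ := by linarith
    positivity
  nlinarith

theorem norm_sub_sq_le_two_mul {E : Type*} [NormedAddCommGroup E] (x y u : E) :
    ‖x - y‖ ^ 2 ≤ 2 * ‖x - u‖ ^ 2 + 2 * ‖y - u‖ ^ 2 := by
  have h : ‖x - y‖ ≤ ‖x - u‖ + ‖y - u‖ := by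
    simpa [norm_sub_rev] using norm_sub_le_norm_sub_add_norm_sub x u y
  nlinarith [sq_nonneg (‖x - u‖ - ‖y - u‖), norm_nonneg (x - y)]

theorem strongConvexOn_sq {s : Set E} (hs : Convex ℝ s) (c : ℝ) (u : E) :
    StrongConvexOn s c (fun w => c / 2 * ‖w - u‖ ^ 2) := by
  refine ⟨hs, fun x _ y _ a b _ _ hab => ?_⟩
  simp only [smul_eq_mul]
  rw [norm_combo_sub_sq x y u hab]
  exact le_of_eq (by ring)

theorem convexOn_inner_left {s : Set E} (hs : Convex ℝ s) (d : E) :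
    ConvexOn ℝ s (fun w => ⟪d, w⟫) := by
  refine ⟨hs, fun x _ y _ a b _ _ hab => ?_⟩
  simp only [smul_eq_mul, inner_add_right, real_inner_smul_right, le_refl]

theorem _root_.StrongConvexOn.add_convexOn' {s : Set E} {m : ℝ} {f g : E → ℝ}
    (hf : StrongConvexOn s m f) (hg : ConvexOn ℝ s g) :
    StrongConvexOn s m (fun x => f x + g x) := by
  refine ⟨hf.1, fun x hx y hy a b ha hb hab => ?_⟩
  have h1 := hf.2 hx hy ha hb hab
  have h2 := hg.2 hx hy ha hb hab
  simp only [smul_eq_mul] at *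
  linarith

theorem _root_.StrongConvexOn.add_strongConvexOn {s : Set E} {m k : ℝ} {f g : E → ℝ}
    (hf : StrongConvexOn s m f) (hg : StrongConvexOn s k g) :
    StrongConvexOn s (m + k) (fun x => f x + g x) := by
  refine ⟨hf.1, fun x hx y hy a b ha hb hab => ?_⟩
  have h1 := hf.2 hx hy ha hb hab
  have h2 := hg.2 hx hy ha hb hab
  simp only [smul_eq_mul] at *
  linarith

/-- Quadratic growth of a strongly convex function around its minimiser. -/
theorem _root_.StrongConvexOn.growth {s : Set E} {m : ℝ} {f : E → ℝ} (hf : StrongConvexOn s m f)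
    {u x : E} (hu : u ∈ s) (hx : x ∈ s) (hmin : ∀ w ∈ s, f u ≤ f w) :
    f u + m / 2 * ‖x - u‖ ^ 2 ≤ f x := by
  -- Strong convexity at `t x + (1 - t) u` combined with minimality of `u`, divided by `t`. The full
  -- constant `m/2` is recovered as `t → 0`.
  have key : ∀ t : ℝ, 0 < t → t < 1 → f u + (1 - t) * (m / 2 * ‖x - u‖ ^ 2) ≤ f x := by
    intro t h0 h1
    have h := hf.2 hx hu h0.le (by linarith : (0 : ℝ) ≤ 1 - t) (by ring)
    have h2 := hmin _ (hf.1 hx hu h0.le (by linarith : (0 : ℝ) ≤ 1 - t) (by ring))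
    simp only [smul_eq_mul] at h
    have h3 : 0 ≤ t * (f x - f u - (1 - t) * (m / 2 * ‖x - u‖ ^ 2)) := by linarith
    have := nonneg_of_mul_nonneg_right h3 h0
    linarith
  have hlim : Filter.Tendsto (fun t : ℝ => f u + (1 - t) * (m / 2 * ‖x - u‖ ^ 2))
      (nhdsWithin 0 (Set.Ioi 0)) (nhds (f u + (1 - 0) * (m / 2 * ‖x - u‖ ^ 2))) := by
    apply Filter.Tendsto.mono_left _ nhdsWithin_le_nhds
    apply Continuous.tendsto
    fun_prop
  have := le_of_tendsto hlim (b := f x) (by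
    filter_upwards [Ioo_mem_nhdsGT (zero_lt_one' ℝ)] with t ht
    exact key t ht.1 ht.2)
  linarith

variable [CompleteSpace E]

/-- First-order condition for convexity. -/
theorem _root_.ConvexOn.inner_gradient_le {f : E → ℝ} (hf : ConvexOn ℝ Set.univ f) {x g : E}
    (hg : HasGradientAt f g x) (w : E) : f x + ⟪g, w - x⟫ ≤ f w := by
  have hl : HasDerivAt (fun t : ℝ => f (x + t • (w - x))) ⟪g, w - x⟫ 0 := by
    have h1 : HasDerivAt (fun t : ℝ => x + t • (w - x)) (w - x) 0 := by
      simpa using ((hasDerivAt_id (0 : ℝ)).smul_const (w - x)).const_add x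
    have h2 : HasFDerivAt f (InnerProductSpace.toDual ℝ E g) (x + (0 : ℝ) • (w - x)) := by
      simpa using hg.hasFDerivAt
    simpa [Function.comp_def] using h2.comp_hasDerivAt (0 : ℝ) h1
  have hc : ConvexOn ℝ Set.univ (fun t : ℝ => f (x + t • (w - x))) := by
    refine ⟨convex_univ, fun s _ t _ a b ha hb hab => ?_⟩
    have h := hf.2 (Set.mem_univ (x + s • (w - x))) (Set.mem_univ (x + t • (w - x))) ha hb hab
    have he : a • (x + s • (w - x)) + b • (x + t • (w - x))
        = x + (a • s + b • t) • (w - x) := by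
      have : x = (a + b) • x := by rw [hab, one_smul]
      simp only [smul_eq_mul]
      conv_rhs => rw [this]
      rw [hab, one_smul]
      have h' : a • x + b • x = x := by rw [← add_smul, hab, one_smul]
      nth_rewrite 5 [← h']
      module
    rwa [he] at h
  have := hc.le_slope_of_hasDerivAt (Set.mem_univ 0) (Set.mem_univ 1) zero_lt_one hl
  simp [slope_def_field] at this
  linarith

/-- The descent lemma. -/
theorem le_quadratic_of_lipschitz_gradient {f : E → ℝ} {g : E → E} {L : ℝ}
    (hg : ∀ x, HasGradientAt f (g x) x) (hL : ∀ x y, ‖g x - g y‖ ≤ L * ‖x - y‖) (x w : E) :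
    f w ≤ f x + ⟪g x, w - x⟫ + L / 2 * ‖w - x‖ ^ 2 := by
  set v := w - x with hv
  -- The derivative of this function is nonpositive on `(0, 1)`, so comparing its values at `0` and
  -- `1` gives the bound without integration.
  have hd : ∀ t : ℝ, HasDerivAt
      (fun t : ℝ => f (x + t • v) - t * ⟪g x, v⟫ - L / 2 * ‖v‖ ^ 2 * t ^ 2)
      (⟪g (x + t • v), v⟫ - ⟪g x, v⟫ - L * ‖v‖ ^ 2 * t) t := by
    intro t
    have h1 : HasDerivAt (fun t : ℝ => x + t • v) v t := by
      simpa using ((hasDerivAt_id t).smul_const v).const_add x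
    have h2 := (hg (x + t • v)).hasFDerivAt.comp_hasDerivAt t h1
    have h3 := (h2.sub ((hasDerivAt_id t).mul_const ⟪g x, v⟫)).sub
      ((hasDerivAt_pow 2 t).const_mul (L / 2 * ‖v‖ ^ 2))
    refine HasDerivAt.congr_deriv h3 ?_
    simp only [InnerProductSpace.toDual_apply_apply]
    push_cast
    ring
  have hanti : AntitoneOn (fun t : ℝ => f (x + t • v) - t * ⟪g x, v⟫ - L / 2 * ‖v‖ ^ 2 * t ^ 2)
      (Set.Icc 0 1) := by
    apply antitoneOn_of_deriv_nonpos (convex_Icc 0 1)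
    · exact fun t _ => (hd t).continuousAt.continuousWithinAt
    · exact fun t _ => (hd t).differentiableAt.differentiableWithinAt
    · intro t ht
      rw [interior_Icc] at ht
      rw [(hd t).deriv, ← inner_sub_left]
      have h1 := real_inner_le_norm (g (x + t • v) - g x) v
      have h2 := hL (x + t • v) x
      rw [add_sub_cancel_left, norm_smul, Real.norm_eq_abs, abs_of_pos ht.1] at h2
      have h3 := mul_le_mul_of_nonneg_right h2 (norm_nonneg v)
      nlinarith
  have := hanti (Set.left_mem_Icc.2 zero_le_one) (Set.right_mem_Icc.2 zero_le_one) zero_le_one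
  simp only [zero_smul, one_smul, add_zero] at this
  have hw : x + v = w := by rw [hv]; abel
  rw [hw] at this
  linarith

end

/-! ### Existence of minimisers from bounded sublevel sets. -/

section

variable {N : ℕ}

theorem exists_forall_le_of_sublevel_bounded {ψ : Vec N → EReal} (hψ : LowerSemicontinuous ψ)
    (x₁ : Vec N) (R : ℝ) (hR : ∀ x, ψ x ≤ ψ x₁ → ‖x‖ ≤ R) : ∃ u, ∀ w, ψ u ≤ ψ w := by
  have h1 : x₁ ∈ Metric.closedBall (0 : Vec N) R := by simpa using hR x₁ le_rfl
  obtain ⟨u, -, hu⟩ := (hψ.lowerSemicontinuousOn _).exists_isMinOn ⟨x₁, h1⟩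
    (isCompact_closedBall (0 : Vec N) R)
  refine ⟨u, fun w => ?_⟩
  by_cases hw : ψ w ≤ ψ x₁
  · exact hu (by simpa using hR w hw)
  · exact (hu h1).trans (not_le.1 hw).le

theorem _root_.LowerSemicontinuous.coe_add {q : Vec N → ℝ} (hq : Continuous q) {h : Vec N → EReal}
    (hh : LowerSemicontinuous h) : LowerSemicontinuous fun x => (q x : EReal) + h x := by
  apply LowerSemicontinuous.add' _ hh
  · intro x
    exact EReal.continuousAt_add (by simp) (by simp)
  · exact (continuous_coe_real_ereal.comp hq).lowerSemicontinuous

/-- A quadratic outgrows a linear function; the explicit bound serves as the radius of a ball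
containing a sublevel set. -/
theorem le_of_quadratic_le {c : ℝ} (hc : 0 < c) {r U M K : ℝ}
    (h : c / 2 * (r - U) ^ 2 ≤ M + K * r) : r ≤ U + 1 + 2 * (|M + K * U| + |K|) / c := by
  by_contra! hr
  have h1 : 2 * (|M + K * U| + |K|) / c < r - U - 1 := by linarith
  rw [div_lt_iff₀ hc] at h1
  have h0 : 0 ≤ 2 * (|M + K * U| + |K|) / c := by positivity
  have h2 : 1 ≤ r - U := by linarith
  have h3 := le_abs_self (M + K * U)
  have h4 := le_abs_self K
  have h5 := abs_nonneg (M + K * U)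
  nlinarith [mul_le_mul_of_nonneg_right h1.le (by linarith : 0 ≤ r - U),
    mul_le_mul_of_nonneg_right h4 (by linarith : 0 ≤ r - U),
    mul_nonneg h5 (by linarith : 0 ≤ r - U - 1)]

end

/-! ### Effective domain, regularisation and the proximal mapping. -/

namespace Problem

variable {N₁ N₂ n₁ n₂ : ℕ} {P : Problem N₁ N₂ n₁ n₂}

/-- The effective domain of `h`. -/
def dom (P : Problem N₁ N₂ n₁ n₂) : Set (Vec N₂) := {x | P.h x ≠ ⊤}

/-- The real-valued version of `h`, meaningful on the domain. -/
noncomputable def hReal (P : Problem N₁ N₂ n₁ n₂) (x : Vec N₂) : ℝ := (P.h x).toReal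

/-- The real-valued version of `H`, meaningful on the domain. -/
noncomputable def HReal (P : Problem N₁ N₂ n₁ n₂) (x : Vec N₂) : ℝ := P.f x + P.hReal x

theorem IsConvex.coe_hReal (hP : P.IsConvex) {x : Vec N₂} (hx : x ∈ P.dom) :
    (P.hReal x : EReal) = P.h x :=
  EReal.coe_toReal hx (hP.h_ne_bot x)

theorem IsConvex.coe_HReal (hP : P.IsConvex) {x : Vec N₂} (hx : x ∈ P.dom) :
    (P.HReal x : EReal) = P.H x := by
  rw [HReal, H, EReal.coe_add, hP.coe_hReal hx]

theorem H_eq_top {x : Vec N₂} (hx : x ∉ P.dom) : P.H x = ⊤ := by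
  rw [H, not_not.1 hx, EReal.coe_add_top]

/-- Convexity of the epigraph is applied to two points of the graph; finiteness of the resulting
bound also gives convexity of the domain. -/
theorem IsConvex.convexOn_hReal (hP : P.IsConvex) : ConvexOn ℝ P.dom P.hReal := by
  have key : ∀ x ∈ P.dom, ∀ y ∈ P.dom, ∀ a b : ℝ, 0 ≤ a → 0 ≤ b → a + b = 1 →
      P.h (a • x + b • y) ≤ ((a * P.hReal x + b * P.hReal y : ℝ) : EReal) := by
    intro x hx y hy a b ha hb hab
    have h := hP.h_convex (x := (x, P.hReal x)) (hP.coe_hReal hx).ge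
      (y := (y, P.hReal y)) (hP.coe_hReal hy).ge ha hb hab
    simpa using h
  have hd : Convex ℝ P.dom := fun x hx y hy a b ha hb hab =>
    ne_top_of_le_ne_top (EReal.coe_ne_top _) (key x hx y hy a b ha hb hab)
  refine ⟨hd, fun x hx y hy a b ha hb hab => ?_⟩
  have h := key x hx y hy a b ha hb hab
  rw [← hP.coe_hReal (hd hx hy ha hb hab)] at h
  exact EReal.coe_le_coe_iff.1 h

theorem regularize_h_ne_top {μ : ℝ} {x₀ x : Vec N₂} :
    (P.regularize μ x₀).h x ≠ ⊤ ↔ P.h x ≠ ⊤ := by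
  change P.h x + ((μ / 2 * ‖x - x₀‖ ^ 2 : ℝ) : EReal) ≠ ⊤ ↔ _
  generalize P.h x = v
  generalize μ / 2 * ‖x - x₀‖ ^ 2 = r
  induction v using EReal.rec with
  | bot => simp
  | top => simp
  | coe r => simp [← EReal.coe_add]

theorem dom_regularize (μ : ℝ) (x₀ : Vec N₂) : (P.regularize μ x₀).dom = P.dom :=
  Set.ext fun _ => regularize_h_ne_top

theorem IsConvex.hReal_regularize (hP : P.IsConvex) (μ : ℝ) (x₀ : Vec N₂) {x : Vec N₂}
    (hx : x ∈ P.dom) :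
    (P.regularize μ x₀).hReal x = P.hReal x + μ / 2 * ‖x - x₀‖ ^ 2 := by
  change (P.h x + ((μ / 2 * ‖x - x₀‖ ^ 2 : ℝ) : EReal)).toReal = _
  rw [← hP.coe_hReal hx, ← EReal.coe_add, EReal.toReal_coe]

theorem IsConvex.HReal_regularize (hP : P.IsConvex) (μ : ℝ) (x₀ : Vec N₂) {x : Vec N₂}
    (hx : x ∈ P.dom) :
    (P.regularize μ x₀).HReal x = P.HReal x + μ / 2 * ‖x - x₀‖ ^ 2 := by
  have : (P.regularize μ x₀).f x = P.f x := rfl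
  rw [HReal, HReal, hP.hReal_regularize μ x₀ hx, this, add_assoc]

theorem IsConvex.strongConvexOn_regularize (hP : P.IsConvex) (μ : ℝ) (x₀ : Vec N₂) :
    StrongConvexOn (P.regularize μ x₀).dom μ (P.regularize μ x₀).hReal := by
  rw [dom_regularize]
  have h := (strongConvexOn_sq hP.convexOn_hReal.1 μ x₀).add_convexOn' hP.convexOn_hReal
  refine ⟨h.1, fun x hx y hy a b ha hb hab => ?_⟩
  rw [hP.hReal_regularize μ x₀ hx, hP.hReal_regularize μ x₀ hy,
    hP.hReal_regularize μ x₀ (h.1 hx hy ha hb hab)]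
  have := h.2 hx hy ha hb hab
  simp only [smul_eq_mul] at *
  linarith

theorem IsConvex.regularize (hP : P.IsConvex) {μ : ℝ} (hμ : 0 ≤ μ) (x₀ : Vec N₂) :
    (P.regularize μ x₀).IsConvex := by
  have hb : ∀ x, (P.regularize μ x₀).h x ≠ ⊥ := fun x => by
    change P.h x + ((μ / 2 * ‖x - x₀‖ ^ 2 : ℝ) : EReal) ≠ ⊥
    have := hP.h_ne_bot x
    generalize P.h x = v at *
    generalize μ / 2 * ‖x - x₀‖ ^ 2 = r
    induction v using EReal.rec with
    | bot => simp at this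
    | top => simp
    | coe r => simp [← EReal.coe_add]
  refine ⟨hP.f_convex, ?_, ?_, hb, ?_⟩
  · have hc : ConvexOn ℝ (P.regularize μ x₀).dom (P.regularize μ x₀).hReal := by
      have := (hP.strongConvexOn_regularize μ x₀).mono hμ
      simpa using this
    have he : {p : Vec N₂ × ℝ | (P.regularize μ x₀).h p.1 ≤ (p.2 : EReal)}
        = {p : Vec N₂ × ℝ | p.1 ∈ (P.regularize μ x₀).dom
            ∧ (P.regularize μ x₀).hReal p.1 ≤ p.2} := by
      ext ⟨x, r⟩
      constructor
      · intro h
        have hx : x ∈ (P.regularize μ x₀).dom := ne_top_of_le_ne_top (EReal.coe_ne_top r) h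
        refine ⟨hx, EReal.coe_le_coe_iff.1 ?_⟩
        rw [hReal, EReal.coe_toReal hx (hb x)]
        exact h
      · rintro ⟨hx, h⟩
        have := EReal.coe_le_coe_iff.2 h
        rw [hReal, EReal.coe_toReal hx (hb x)] at this
        exact this
    rw [he]
    exact hc.convex_epigraph
  · have : (P.regularize μ x₀).h
        = fun x => ((μ / 2 * ‖x - x₀‖ ^ 2 : ℝ) : EReal) + P.h x :=
      funext fun x => add_comm _ _
    rw [this]
    exact LowerSemicontinuous.coe_add (by fun_prop) hP.h_closed
  · obtain ⟨x, hx⟩ := hP.h_proper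
    exact ⟨x, regularize_h_ne_top.2 hx⟩

/-- `h` is bounded below by a function of linear growth. -/
def HasLinearMinorant (P : Problem N₁ N₂ n₁ n₂) : Prop :=
  ∃ a K : ℝ, ∀ x ∈ P.dom, a - K * ‖x‖ ≤ P.hReal x

theorem HasLinearMinorant.regularize (h : P.HasLinearMinorant) (hP : P.IsConvex) {μ : ℝ}
    (hμ : 0 ≤ μ) (x₀ : Vec N₂) : (P.regularize μ x₀).HasLinearMinorant := by
  obtain ⟨a, K, h⟩ := h
  refine ⟨a, K, fun x hx => ?_⟩
  rw [dom_regularize] at hx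
  rw [hP.hReal_regularize μ x₀ hx]
  have := h x hx
  have : 0 ≤ μ / 2 * ‖x - x₀‖ ^ 2 := by positivity
  linarith

/-- The quadratic lower bound makes sublevel sets bounded, and lower semicontinuity does the rest.
It serves both the proximal subproblem and the regularised objective. -/
theorem IsConvex.exists_isMin_add (hP : P.IsConvex) {q : Vec N₂ → ℝ} (hq : Continuous q)
    {c U M K : ℝ} (hc : 0 < c)
    (hb : ∀ x ∈ P.dom, c / 2 * (‖x‖ - U) ^ 2 - M - K * ‖x‖ ≤ q x + P.hReal x) :
    ∃ u ∈ P.dom, ∀ w, (q u : EReal) + P.h u ≤ (q w : EReal) + P.h w := by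
  obtain ⟨x₁, hx₁⟩ := hP.h_proper
  have hcoe : ∀ x ∈ P.dom, (q x : EReal) + P.h x = ((q x + P.hReal x : ℝ) : EReal) := by
    intro x hx
    rw [EReal.coe_add, hP.coe_hReal hx]
  have hdom : ∀ x, (q x : EReal) + P.h x ≤ (q x₁ : EReal) + P.h x₁ → x ∈ P.dom := by
    intro x hx htop
    rw [htop, EReal.coe_add_top, hcoe x₁ hx₁] at hx
    exact absurd (top_le_iff.1 hx) (EReal.coe_ne_top _)
  obtain ⟨u, hu⟩ := exists_forall_le_of_sublevel_bounded
    (LowerSemicontinuous.coe_add hq hP.h_closed) x₁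
    (U + 1 + 2 * (|(q x₁ + P.hReal x₁ + M) + K * U| + |K|) / c) (fun x hx => by
      have hxd := hdom x hx
      rw [hcoe x hxd, hcoe x₁ hx₁, EReal.coe_le_coe_iff] at hx
      have := hb x hxd
      exact le_of_quadratic_le hc (by linarith))
  exact ⟨u, hdom u (hu x₁), hu⟩

/-- The choice operator in `prox` says something only once a minimiser exists, which holds because
the quadratic dominates the linear minorant of `h`. The gain `(c + μ)/2` is quadratic growth, the
moduli of the proximal term and of `h` adding up. -/
theorem IsConvex.prox_spec (hP : P.IsConvex) (hlin : P.HasLinearMinorant) {μ : ℝ}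
    (hsc : StrongConvexOn P.dom μ P.hReal) (d : Vec N₂) {c : ℝ} (hc : 0 < c) (u : Vec N₂) :
    P.prox d c u ∈ P.dom ∧ ∀ w ∈ P.dom,
      ⟪d, P.prox d c u⟫ + c / 2 * ‖P.prox d c u - u‖ ^ 2 + P.hReal (P.prox d c u)
        + (c + μ) / 2 * ‖w - P.prox d c u‖ ^ 2
      ≤ ⟪d, w⟫ + c / 2 * ‖w - u‖ ^ 2 + P.hReal w := by
  obtain ⟨a, K, hlin⟩ := hlin
  have hex : ∃ z ∈ P.dom, ∀ w,
      ((⟪d, z⟫ + c / 2 * ‖z - u‖ ^ 2 : ℝ) : EReal) + P.h z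
        ≤ ((⟪d, w⟫ + c / 2 * ‖w - u‖ ^ 2 : ℝ) : EReal) + P.h w := by
    refine hP.exists_isMin_add (q := fun z => ⟪d, z⟫ + c / 2 * ‖z - u‖ ^ 2) (by fun_prop) hc
      (U := ‖u‖) (M := -a) (K := K + ‖d‖) (fun x hx => ?_)
    have h1 := hlin x hx
    have h2 := (abs_le.1 (abs_real_inner_le_norm d x)).1
    have h3 : (‖x‖ - ‖u‖) ^ 2 ≤ ‖x - u‖ ^ 2 := sq_le_sq' (by
      have := norm_sub_norm_le u x
      rw [norm_sub_rev] at this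
      linarith) (norm_sub_norm_le x u)
    have h4 := mul_le_mul_of_nonneg_left h3 (by positivity : 0 ≤ c / 2)
    linarith
  have hspec : ∀ w, ((⟪d, P.prox d c u⟫ + c / 2 * ‖P.prox d c u - u‖ ^ 2 : ℝ) : EReal)
      + P.h (P.prox d c u) ≤ ((⟪d, w⟫ + c / 2 * ‖w - u‖ ^ 2 : ℝ) : EReal) + P.h w := by
    obtain ⟨z, -, hz⟩ := hex
    exact Classical.epsilon_spec (p := fun z => ∀ w,
      ((⟪d, z⟫ + c / 2 * ‖z - u‖ ^ 2 : ℝ) : EReal) + P.h z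
        ≤ ((⟪d, w⟫ + c / 2 * ‖w - u‖ ^ 2 : ℝ) : EReal) + P.h w) ⟨z, hz⟩
  have hdom : P.prox d c u ∈ P.dom := by
    obtain ⟨x₁, hx₁⟩ := hP.h_proper
    intro htop
    have := hspec x₁
    rw [htop, EReal.coe_add_top, ← hP.coe_hReal hx₁, ← EReal.coe_add] at this
    exact absurd (top_le_iff.1 this) (EReal.coe_ne_top _)
  refine ⟨hdom, fun w hw => ?_⟩
  have hs : StrongConvexOn P.dom (c + μ)
      (fun w => (c / 2 * ‖w - u‖ ^ 2 + ⟪d, w⟫) + P.hReal w) :=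
    ((strongConvexOn_sq hsc.1 c u).add_convexOn'
      (convexOn_inner_left hsc.1 d)).add_strongConvexOn hsc
  have := hs.growth hdom hw (fun w hw => by
    have := hspec w
    rw [← hP.coe_hReal hw, ← hP.coe_hReal hdom, ← EReal.coe_add, ← EReal.coe_add,
      EReal.coe_le_coe_iff] at this
    linarith)
  linarith

/-- The gap at a point of the domain, in terms of a minimiser. -/
theorem IsConvex.gap_eq (hP : P.IsConvex) {u x : Vec N₂} (hu : ∀ w, P.H u ≤ P.H w)
    (hud : u ∈ P.dom) (hx : x ∈ P.dom) :
    P.gap x = ENNReal.ofReal (P.HReal x - P.HReal u) := by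
  have : P.optVal = P.HReal u := by
    rw [hP.coe_HReal hud]
    exact le_antisymm (iInf_le _ u) (le_iInf hu)
  rw [gap, this, ← hP.coe_HReal hx, ← EReal.coe_sub, EReal.toENNReal_of_ne_top (EReal.coe_ne_top _)]
  rfl

theorem IsConvex.gap_eq_top (hP : P.IsConvex) {u x : Vec N₂} (hu : ∀ w, P.H u ≤ P.H w)
    (hud : u ∈ P.dom) (hx : x ∉ P.dom) : P.gap x = ⊤ := by
  have : P.optVal = P.HReal u := by
    rw [hP.coe_HReal hud]
    exact le_antisymm (iInf_le _ u) (le_iInf hu)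
  rw [gap, this, H_eq_top hx]
  simp

theorem IsConvex.HReal_min (hP : P.IsConvex) {u w : Vec N₂} (hu : ∀ w, P.H u ≤ P.H w)
    (hud : u ∈ P.dom) (hw : w ∈ P.dom) : P.HReal u ≤ P.HReal w := by
  have := hu w
  rwa [← hP.coe_HReal hw, ← hP.coe_HReal hud, EReal.coe_le_coe_iff] at this

end Problem

/-! ### The variance of batch averages -/

section

variable {V : Type*} [NormedAddCommGroup V] [InnerProductSpace ℝ V]

theorem norm_average_le {V : Type*} [NormedAddCommGroup V] [NormedSpace ℝ V] {n : ℕ} [NeZero n]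
    {v : Fin n → V} {R : ℝ} (h : ∀ j, ‖v j‖ ≤ R) :
    ‖(1 / (n : ℝ)) • ∑ j, v j‖ ≤ R := by
  have hn : (0 : ℝ) < n := by exact_mod_cast Nat.pos_of_ne_zero (NeZero.ne n)
  rw [norm_smul, Real.norm_of_nonneg (by positivity), one_div, inv_mul_le_iff₀ hn]
  calc ‖∑ j, v j‖ ≤ ∑ j, ‖v j‖ := norm_sum_le _ _
    _ ≤ ∑ _j : Fin n, R := Finset.sum_le_sum fun j _ => h j
    _ = n * R := by simp

/-- Independence in counting form: after splitting off the first sample, summing over its index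
kills the cross term because `∑ Y = 0`. The factor `n` avoids a division. -/
theorem sum_norm_sq_sum_batch {n : ℕ} (Y : Fin n → V) (hY : ∑ j, Y j = 0) (A : ℕ) :
    (n : ℝ) * ∑ a : Fin A → Fin n, ‖∑ i, Y (a i)‖ ^ 2 = A * n ^ A * ∑ j, ‖Y j‖ ^ 2 := by
  induction A with
  | zero => simp
  | succ A ih =>
    have h : ∑ a : Fin (A + 1) → Fin n, ‖∑ i, Y (a i)‖ ^ 2
        = ∑ a : Fin A → Fin n, ∑ j, ‖Y j + ∑ i, Y (a i)‖ ^ 2 := by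
      rw [← (Fin.consEquiv (fun _ : Fin (A + 1) => Fin n)).sum_comp, Fintype.sum_prod_type_right]
      simp [Fin.consEquiv, Fin.sum_univ_succ]
    have h2 : ∀ a : Fin A → Fin n, ∑ j, ‖Y j + ∑ i, Y (a i)‖ ^ 2
        = ∑ j, ‖Y j‖ ^ 2 + n * ‖∑ i, Y (a i)‖ ^ 2 := by
      intro a
      simp only [norm_add_sq_real, Finset.sum_add_distrib, ← Finset.mul_sum, ← sum_inner, hY,
        inner_zero_left]
      simp
    rw [h, Finset.sum_congr rfl (fun a _ => h2 a), Finset.sum_add_distrib, ← Finset.mul_sum,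
      mul_add, ih]
    simp
    ring

/-- Variance is at most the second moment. -/
theorem sum_norm_sub_average_sq_le {n : ℕ} [NeZero n] (X : Fin n → V) :
    ∑ j, ‖X j - (1 / (n : ℝ)) • ∑ k, X k‖ ^ 2 ≤ ∑ j, ‖X j‖ ^ 2 := by
  have hn : (n : ℝ) ≠ 0 := by exact_mod_cast NeZero.ne n
  set c := (1 / (n : ℝ)) • ∑ k, X k with hc
  have hs : ∑ k, X k = (n : ℝ) • c := by
    rw [hc, smul_smul, mul_one_div_cancel hn, one_smul]
  simp only [norm_sub_sq_real, Finset.sum_add_distrib, Finset.sum_sub_distrib, ← Finset.mul_sum,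
    ← sum_inner, hs, real_inner_smul_left, real_inner_self_eq_norm_sq]
  simp
  have : 0 ≤ (n : ℝ) * ‖c‖ ^ 2 := by positivity
  linarith

/-- The variance of the average of a batch of `A` independent uniform samples. -/
theorem expect_norm_batch_sub_average_sq_le {n A : ℕ} [NeZero n] (hA : 0 < A) (X : Fin n → V)
    {R : ℝ} (hX : ∀ j, ‖X j‖ ^ 2 ≤ R) :
    Finset.univ.expect (fun a : Fin A → Fin n =>
      ‖(1 / (A : ℝ)) • ∑ i, X (a i) - (1 / (n : ℝ)) • ∑ k, X k‖ ^ 2) ≤ R / A := by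
  have hn : (0 : ℝ) < n := by exact_mod_cast Nat.pos_of_ne_zero (NeZero.ne n)
  have hA' : (0 : ℝ) < A := by exact_mod_cast hA
  set c := (1 / (n : ℝ)) • ∑ k, X k with hc
  have hY : ∑ j, (X j - c) = 0 := by
    rw [Finset.sum_sub_distrib]
    simp [hc, ← Nat.cast_smul_eq_nsmul ℝ, smul_smul, hn.ne']
  have h1 : ∀ a : Fin A → Fin n, ‖(1 / (A : ℝ)) • ∑ i, X (a i) - c‖ ^ 2
      = (1 / (A : ℝ)) ^ 2 * ‖∑ i, (X (a i) - c)‖ ^ 2 := by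
    intro a
    rw [← mul_pow, ← Real.norm_of_nonneg (by positivity : 0 ≤ 1 / (A : ℝ)), ← norm_smul,
      Finset.sum_sub_distrib, smul_sub, Real.norm_of_nonneg (by positivity : 0 ≤ 1 / (A : ℝ))]
    congr 3
    simp [← Nat.cast_smul_eq_nsmul ℝ, smul_smul, hA'.ne']
  have h2 := sum_norm_sq_sum_batch (fun j => X j - c) hY A
  have h3 : ∑ j, ‖X j - c‖ ^ 2 ≤ n * R :=
    (sum_norm_sub_average_sq_le X).trans
      ((Finset.sum_le_sum fun j _ => hX j).trans (by simp))
  rw [Finset.expect_eq_sum_div_card, Finset.sum_congr rfl (fun a _ => h1 a), ← Finset.mul_sum]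
  simp only [Finset.card_univ, Fintype.card_pi, Fintype.card_fin, Finset.prod_const]
  push_cast
  have h4 : ∑ a : Fin A → Fin n, ‖∑ i, (X (a i) - c)‖ ^ 2 ≤ A * n ^ A * R := by
    have : (n : ℝ) * ∑ a : Fin A → Fin n, ‖∑ i, (X (a i) - c)‖ ^ 2 ≤ n * (A * n ^ A * R) := by
      rw [h2]
      have := mul_le_mul_of_nonneg_left h3 (by positivity : (0 : ℝ) ≤ A * n ^ A)
      linarith
    exact le_of_mul_le_mul_left this hn
  rw [div_le_iff₀ (by positivity)]
  calc _ ≤ (1 / (A : ℝ)) ^ 2 * (A * n ^ A * R) := by gcongr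
    _ = R / A * n ^ A := by field_simp

end

namespace Problem

variable {N₁ N₂ n₁ n₂ : ℕ} {P : Problem N₁ N₂ n₁ n₂} {L_F B_F L_G B_G L : ℝ}

/-! ### The gradient of the smooth part -/

/-- The gradient of `f`. -/
noncomputable def gradf (P : Problem N₁ N₂ n₁ n₂) (x : Vec N₂) : Vec N₂ :=
  (P.jac x).adjoint (P.outerGrad (P.inner x))

theorem SmoothBounded.hasFDerivAt_inner (h : P.SmoothBounded L_F B_F L_G B_G) (x : Vec N₂) :
    HasFDerivAt P.inner (P.jac x) x := by
  have := HasFDerivAt.fun_sum (u := Finset.univ) fun j _ => (h.G_diff j x).hasFDerivAt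
  exact this.const_smul (1 / (n₂ : ℝ))

theorem SmoothBounded.hasGradientAt_outer (h : P.SmoothBounded L_F B_F L_G B_G) (u : Vec N₁) :
    HasGradientAt P.outer (P.outerGrad u) u := by
  have := HasFDerivAt.fun_sum (u := Finset.univ)
    fun i _ => (h.F_diff i u).hasGradientAt.hasFDerivAt
  rw [hasGradientAt_iff_hasFDerivAt, outerGrad, map_smul, map_sum]
  exact this.const_smul (1 / (n₁ : ℝ))

theorem SmoothBounded.hasGradientAt_f (h : P.SmoothBounded L_F B_F L_G B_G) (x : Vec N₂) :
    HasGradientAt P.f (P.gradf x) x := by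
  rw [hasGradientAt_iff_hasFDerivAt]
  have := (h.hasGradientAt_outer (P.inner x)).hasFDerivAt.comp x (h.hasFDerivAt_inner x)
  refine this.congr_fderiv ?_
  ext v
  simp [gradf, ContinuousLinearMap.adjoint_inner_left]

theorem SmoothBounded.norm_outerGrad_le [NeZero n₁] (h : P.SmoothBounded L_F B_F L_G B_G)
    (u : Vec N₁) : ‖P.outerGrad u‖ ≤ B_F :=
  norm_average_le fun i => h.F_bound i u

theorem SmoothBounded.norm_outerGrad_sub_le [NeZero n₁] (h : P.SmoothBounded L_F B_F L_G B_G)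
    (u v : Vec N₁) : ‖P.outerGrad u - P.outerGrad v‖ ≤ L_F * ‖u - v‖ := by
  rw [outerGrad, outerGrad, ← smul_sub, ← Finset.sum_sub_distrib]
  exact norm_average_le fun i => h.F_smooth i u v

theorem SmoothBounded.norm_jac_le [NeZero n₂] (h : P.SmoothBounded L_F B_F L_G B_G)
    (x : Vec N₂) : ‖P.jac x‖ ≤ B_G :=
  norm_average_le fun j => h.G_bound j x

theorem SmoothBounded.norm_G_sub_le (h : P.SmoothBounded L_F B_F L_G B_G) (j : Fin n₂)
    (x y : Vec N₂) : ‖P.G j x - P.G j y‖ ≤ B_G * ‖x - y‖ :=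
  convex_univ.norm_image_sub_le_of_norm_fderiv_le (fun x _ => h.G_diff j x)
    (fun x _ => h.G_bound j x) (Set.mem_univ y) (Set.mem_univ x)

/-- `∇f` is the average over all pairs `(i, j)` of the maps assumed to be `L`-Lipschitz. -/
theorem JointSmooth.norm_gradf_sub_le [NeZero n₁] [NeZero n₂] (h : P.JointSmooth L)
    (x y : Vec N₂) : ‖P.gradf x - P.gradf y‖ ≤ L * ‖x - y‖ := by
  have he : ∀ x, P.gradf x = (1 / (n₂ : ℝ)) • ∑ j, (1 / (n₁ : ℝ)) • ∑ i,
      (fderiv ℝ (P.G j) x).adjoint (gradient (P.F i) (P.inner x)) := by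
    intro x
    simp only [gradf, jac, outerGrad, map_smulₛₗ, map_sum, _root_.smul_apply,
      _root_.sum_apply, RCLike.conj_to_real, RingHom.id_apply,
      Finset.smul_sum]
    rw [Finset.sum_comm]
    simp only [smul_comm (1 / (n₁ : ℝ))]
  rw [he, he, ← smul_sub, ← Finset.sum_sub_distrib]
  refine norm_average_le fun j => ?_
  rw [← smul_sub, ← Finset.sum_sub_distrib]
  exact norm_average_le fun i => h i j x y

theorem SmoothBounded.norm_gradf_le [NeZero n₁] [NeZero n₂]
    (h : P.SmoothBounded L_F B_F L_G B_G) (x : Vec N₂) : ‖P.gradf x‖ ≤ B_G * B_F := by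
  have hB : 0 ≤ B_G := (norm_nonneg _).trans (h.norm_jac_le x)
  calc ‖P.gradf x‖ ≤ ‖(P.jac x).adjoint‖ * ‖P.outerGrad (P.inner x)‖ :=
        ContinuousLinearMap.le_opNorm _ _
    _ ≤ B_G * B_F := by
      rw [LinearIsometryEquiv.norm_map]
      exact mul_le_mul (h.norm_jac_le x) (h.norm_outerGrad_le _) (norm_nonneg _) hB

theorem SmoothBounded.abs_f_sub_le [NeZero n₁] [NeZero n₂]
    (h : P.SmoothBounded L_F B_F L_G B_G) (x y : Vec N₂) :
    |P.f x - P.f y| ≤ B_G * B_F * ‖x - y‖ := by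
  have := convex_univ.norm_image_sub_le_of_norm_hasFDerivWithin_le (𝕜 := ℝ) (f := P.f)
    (fun x _ => (h.hasGradientAt_f x).hasFDerivAt.hasFDerivWithinAt)
    (C := B_G * B_F) (fun x _ => by
      rw [LinearIsometryEquiv.norm_map]
      exact h.norm_gradf_le x) (Set.mem_univ y) (Set.mem_univ x)
  simpa using this

theorem mem_dom_of_isMin {P : Problem N₁ N₂ n₁ n₂} (hP : P.IsConvex) {u : Vec N₂}
    (hu : ∀ w, P.H u ≤ P.H w) : u ∈ P.dom := by
  obtain ⟨x, hx⟩ := hP.h_proper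
  intro htop
  have := hu x
  rw [H, htop, EReal.coe_add_top, ← hP.coe_HReal hx] at this
  exact absurd (top_le_iff.1 this) (EReal.coe_ne_top _)

/-- `h = H - f`, where `H` is bounded below by its minimum and `f` is Lipschitz; no subgradient of
`h` is needed. -/
theorem SmoothBounded.hasLinearMinorant [NeZero n₁] [NeZero n₂]
    (h : P.SmoothBounded L_F B_F L_G B_G) (hP : P.IsConvex) {u : Vec N₂}
    (hu : ∀ w, P.H u ≤ P.H w) : P.HasLinearMinorant := by
  have hud := mem_dom_of_isMin hP hu
  refine ⟨P.HReal u - P.f u - B_G * B_F * ‖u‖, B_G * B_F, fun x hx => ?_⟩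
  have h1 := hP.HReal_min hu hud hx
  have h2 := (abs_le.1 (h.abs_f_sub_le x u)).2
  have h3 : 0 ≤ B_G * B_F := (norm_nonneg _).trans (h.norm_gradf_le x)
  have h4 := mul_le_mul_of_nonneg_left (norm_sub_le x u) h3
  rw [HReal, HReal] at *
  linarith

/-- The regularised problem has a minimiser. -/
theorem SmoothBounded.exists_isMin_regularize [NeZero n₁] [NeZero n₂]
    (h : P.SmoothBounded L_F B_F L_G B_G) (hP : P.IsConvex) {u : Vec N₂}
    (hu : ∀ w, P.H u ≤ P.H w) {μ : ℝ} (hμ : 0 < μ) (x₀ : Vec N₂) :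
    ∃ v ∈ P.dom, ∀ w, (P.regularize μ x₀).H v ≤ (P.regularize μ x₀).H w := by
  have hud := mem_dom_of_isMin hP hu
  have hd : Differentiable ℝ P.f := fun x => (h.hasGradientAt_f x).hasFDerivAt.differentiableAt
  have hfc : Continuous P.f := hd.continuous
  have hmin := hP.exists_isMin_add (q := fun x => P.f x + μ / 2 * ‖x - x₀‖ ^ 2)
    (by fun_prop) hμ (U := ‖x₀‖) (M := -P.HReal u) (K := 0) (fun x hx => by
      have h1 := hP.HReal_min hu hud hx
      have h3 : (‖x‖ - ‖x₀‖) ^ 2 ≤ ‖x - x₀‖ ^ 2 := sq_le_sq' (by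
        have := norm_sub_norm_le x₀ x
        rw [norm_sub_rev] at this
        linarith) (norm_sub_norm_le x x₀)
      have h4 := mul_le_mul_of_nonneg_left h3 (by positivity : 0 ≤ μ / 2)
      rw [HReal, HReal] at *
      linarith)
  have he : ∀ x, (P.regularize μ x₀).H x
      = ((P.f x + μ / 2 * ‖x - x₀‖ ^ 2 : ℝ) : EReal) + P.h x := by
    intro x
    change (P.f x : EReal) + (P.h x + ((μ / 2 * ‖x - x₀‖ ^ 2 : ℝ) : EReal)) = _
    rw [EReal.coe_add, add_assoc, add_comm (P.h x)]
  obtain ⟨v, hv, hv'⟩ := hmin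
  refine ⟨v, hv, fun w => ?_⟩
  rw [he, he]
  exact hv' w

end Problem

/-! ### The error of the gradient estimate -/

section

variable {N₁ N₂ n₁ n₂ : ℕ} [NeZero n₂] {P : Problem N₁ N₂ n₁ n₂}
  {L_F B_F L_G B_G : ℝ}

/-- The error of the estimate is a batch average minus the full average of the differences `G_j x -
G_j xs`, each of norm at most `B_G ‖x - xs‖`. -/
theorem expect_norm_estG_sub_sq_le (h : P.SmoothBounded L_F B_F L_G B_G) {A : ℕ} (hA : 0 < A)
    (xs x : Vec N₂) :
    Finset.univ.expect (fun a : Fin A → Fin n₂ => ‖estG P xs x a - P.inner x‖ ^ 2)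
      ≤ (B_G * ‖x - xs‖) ^ 2 / A := by
  have := expect_norm_batch_sub_average_sq_le hA (fun j => P.G j x - P.G j xs)
    (R := (B_G * ‖x - xs‖) ^ 2)
    (fun j => pow_le_pow_left₀ (norm_nonneg _) (h.norm_G_sub_le j x xs) 2)
  refine le_trans (le_of_eq ?_) this
  congr 1
  funext a
  rw [estG, Problem.inner, Problem.inner,
    Finset.sum_sub_distrib (s := (Finset.univ : Finset (Fin n₂))),
    smul_sub (1 / (n₂ : ℝ))]
  congr 2
  abel

/-- The operator norm is not Euclidean, so the Jacobian error is applied to a fixed vector `w`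
first; the variance bound then holds in `ℝ^{N₂}` with no dimension factor. -/
theorem expect_norm_estJac_sub_sq_le (h : P.SmoothBounded L_F B_F L_G B_G) {B : ℕ} (hB : 0 < B)
    (xs x : Vec N₂) {w : Vec N₁} (hw : ‖w‖ ≤ B_F) :
    Finset.univ.expect (fun b : Fin B → Fin n₂ => ‖(estJac P xs x b - P.jac x).adjoint w‖ ^ 2)
      ≤ (L_G * ‖x - xs‖ * B_F) ^ 2 / B := by
  have := expect_norm_batch_sub_average_sq_le hB
    (fun j => (fderiv ℝ (P.G j) x - fderiv ℝ (P.G j) xs).adjoint w)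
    (R := (L_G * ‖x - xs‖ * B_F) ^ 2) (fun j => pow_le_pow_left₀ (norm_nonneg _) (by
      refine (ContinuousLinearMap.le_opNorm _ _).trans ?_
      rw [LinearIsometryEquiv.norm_map]
      exact mul_le_mul (h.G_smooth j x xs) hw (norm_nonneg _)
        ((norm_nonneg _).trans (h.G_smooth j x xs))) 2)
  refine le_trans (le_of_eq ?_) this
  congr 1
  funext b
  congr 2
  simp only [estJac, Problem.jac, map_add, map_sub, map_smulₛₗ, map_sum,
    _root_.smul_apply, _root_.sum_apply, RCLike.conj_to_real,
    _root_.sub_apply, _root_.add_apply, Finset.sum_sub_distrib]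
  module

/-- The split leaves the Jacobian error acting on a vector determined by the batch `a` alone, which
is fixed when averaging over the independent batch `b`. -/
theorem norm_estGrad_sub_sq_le [NeZero n₁] (h : P.SmoothBounded L_F B_F L_G B_G) {A B : ℕ}
    (xs x : Vec N₂) (a : Fin A → Fin n₂) (b : Fin B → Fin n₂) :
    ‖estGrad P xs x a b - P.gradf x‖ ^ 2
      ≤ 2 * (B_G * L_F) ^ 2 * ‖estG P xs x a - P.inner x‖ ^ 2
        + 2 * ‖(estJac P xs x b - P.jac x).adjoint (P.outerGrad (estG P xs x a))‖ ^ 2 := by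
  have he : estGrad P xs x a b - P.gradf x
      = (P.jac x).adjoint (P.outerGrad (estG P xs x a) - P.outerGrad (P.inner x))
        + (estJac P xs x b - P.jac x).adjoint (P.outerGrad (estG P xs x a)) := by
    simp only [estGrad, Problem.gradf, map_sub, _root_.sub_apply]
    abel
  have hB : 0 ≤ B_G := (norm_nonneg _).trans (h.norm_jac_le x)
  have h1 : ‖(P.jac x).adjoint (P.outerGrad (estG P xs x a) - P.outerGrad (P.inner x))‖
      ≤ B_G * L_F * ‖estG P xs x a - P.inner x‖ := by
    refine (ContinuousLinearMap.le_opNorm _ _).trans ?_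
    rw [LinearIsometryEquiv.norm_map, mul_assoc]
    exact mul_le_mul (h.norm_jac_le x) (h.norm_outerGrad_sub_le _ _) (norm_nonneg _) hB
  have h2 := pow_le_pow_left₀ (norm_nonneg _) h1 2
  rw [mul_pow] at h2
  rw [he]
  set p := (P.jac x).adjoint (P.outerGrad (estG P xs x a) - P.outerGrad (P.inner x))
  set q := (estJac P xs x b - P.jac x).adjoint (P.outerGrad (estG P xs x a))
  have h3 := pow_le_pow_left₀ (norm_nonneg _) (norm_add_le p q) 2
  nlinarith [sq_nonneg (‖p‖ - ‖q‖)]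

/-- The mean square error of the (biased) gradient estimate; conditioning on the batch for `G`
makes the bound dimension-free. -/
theorem expect_norm_estGrad_sub_sq_le [NeZero n₁] (h : P.SmoothBounded L_F B_F L_G B_G) {A B : ℕ}
    (hA : 0 < A) (hB : 0 < B) (xs x : Vec N₂) :
    Finset.univ.expect (fun a : Fin A → Fin n₂ => Finset.univ.expect (fun b : Fin B → Fin n₂ =>
        ‖estGrad P xs x a b - P.gradf x‖ ^ 2))
      ≤ 2 * (B_G ^ 4 * L_F ^ 2 / A + B_F ^ 2 * L_G ^ 2 / B) * ‖x - xs‖ ^ 2 := by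
  have h1 : ∀ a : Fin A → Fin n₂, Finset.univ.expect (fun b : Fin B → Fin n₂ =>
      ‖estGrad P xs x a b - P.gradf x‖ ^ 2)
      ≤ 2 * (B_G * L_F) ^ 2 * ‖estG P xs x a - P.inner x‖ ^ 2
        + 2 * ((L_G * ‖x - xs‖ * B_F) ^ 2 / B) := by
    intro a
    refine (Finset.expect_le_expect fun b _ => norm_estGrad_sub_sq_le h xs x a b).trans ?_
    rw [Finset.expect_add_distrib, Fintype.expect_const, ← Finset.mul_expect]
    have := expect_norm_estJac_sub_sq_le h hB xs x (h.norm_outerGrad_le (estG P xs x a))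
    linarith
  refine (Finset.expect_le_expect fun a _ => h1 a).trans ?_
  rw [Finset.expect_add_distrib, Fintype.expect_const, ← Finset.mul_expect]
  have h2 := mul_le_mul_of_nonneg_left (expect_norm_estG_sub_sq_le h hA xs x)
    (by positivity : 0 ≤ 2 * (B_G * L_F) ^ 2)
  refine (add_le_add_left h2 _).trans (le_of_eq ?_)
  ring

end

/-! ### Parameters -/

/-- The relations between the parameters that the analysis of SoCK uses. -/
structure Params.IsAdmissible (q : Params) (L L_F B_F L_G B_G μ τ : ℝ) : Prop where
  L_eq : q.L = L
  τ₁_eq : q.τ₁ = τ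
  τ₂_eq : q.τ₂ = τ
  α_eq : 1 / q.α = 3 * τ * L
  θ_eq : q.θ = 1 + τ / 6
  m_mul : (q.m : ℝ) * τ = 1 / 2
  τ_pos : 0 < τ
  τ_le : τ ≤ 1 / 2
  μ_pos : 0 < μ
  L_pos : 0 < L
  sq_le : τ ^ 2 * L ≤ μ
  le_sq : μ ≤ 4 * τ ^ 2 * L
  A_pos : 0 < q.A
  B_pos : 0 < q.B
  A_bound : B_G ^ 4 * L_F ^ 2 / q.A ≤ μ ^ 2 / 720
  B_bound : B_F ^ 2 * L_G ^ 2 / q.B ≤ μ ^ 2 / 720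

theorem one_le_ceil_half_sqrt {r : ℝ} (hr : 1 ≤ r) : 1 ≤ ⌈1 / 2 * √r⌉₊ := by
  rw [Nat.one_le_ceil_iff]
  have : 0 < √r := Real.sqrt_pos.2 (by linarith)
  linarith

/-- As `√r ≥ 1`, rounding `√r / 2` up costs at most a factor tied to `√r`: either the ceiling is
`1`, or `√r > 2` and adding `1` is harmless. -/
theorem ceil_half_sqrt_le {r : ℝ} (hr : 1 ≤ r) : (⌈1 / 2 * √r⌉₊ : ℝ) ≤ √r := by
  have h1 : 1 ≤ √r := Real.one_le_sqrt.2 hr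
  by_cases h : √r ≤ 2
  · have : ⌈1 / 2 * √r⌉₊ ≤ 1 := Nat.ceil_le.2 (by push_cast; linarith)
    have : (⌈1 / 2 * √r⌉₊ : ℝ) ≤ 1 := by exact_mod_cast this
    linarith
  · have := Nat.ceil_lt_add_one (by positivity : 0 ≤ 1 / 2 * √r)
    rw [not_le] at h
    linarith

theorem div_batch_le {v μ : ℝ} (hμ : 0 < μ) {A : ℕ} (hA : 0 < A) (h : 720 * v / μ ^ 2 ≤ A) :
    v / A ≤ μ ^ 2 / 720 := by
  have hA' : (0 : ℝ) < A := by exact_mod_cast hA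
  rw [div_le_iff₀ (by positivity)] at h
  rw [div_le_iff₀ hA']
  linarith

/-- With `τ = 1/(2m)`, the bounds `√(L/μ)/2 ≤ m ≤ √(L/μ)` are the two comparisons of `μ` with `τ²
L`. -/
theorem sockParams_isAdmissible {L L_F B_F L_G B_G μ : ℝ} (hμ : 0 < μ) (hL : μ ≤ L) :
    (sockParams L L_F B_F L_G B_G μ).IsAdmissible L L_F B_F L_G B_G μ
      (1 / (2 * (⌈1 / 2 * √(L / μ)⌉₊ : ℝ))) := by
  have hr : 1 ≤ L / μ := (one_le_div hμ).2 hL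
  have hLp : 0 < L := hμ.trans_le hL
  have h1 := one_le_ceil_half_sqrt hr
  have h2 := ceil_half_sqrt_le hr
  have h3 := Nat.le_ceil (1 / 2 * √(L / μ))
  have hm : (sockParams L L_F B_F L_G B_G μ).m = ⌈1 / 2 * √(L / μ)⌉₊ := rfl
  set m := ⌈1 / 2 * √(L / μ)⌉₊ with hmdef
  have h1' : (1 : ℝ) ≤ m := by exact_mod_cast h1
  have hsq : √(L / μ) ^ 2 = L / μ := Real.sq_sqrt (by positivity)
  have hs0 := Real.sqrt_nonneg (L / μ)
  have hA : 0 < (sockParams L L_F B_F L_G B_G μ).A := lt_of_lt_of_le one_pos (le_max_left _ _)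
  have hB : 0 < (sockParams L L_F B_F L_G B_G μ).B := lt_of_lt_of_le one_pos (le_max_left _ _)
  have hA2 : 720 * (B_G ^ 4 * L_F ^ 2) / μ ^ 2 ≤ (sockParams L L_F B_F L_G B_G μ).A := by
    rw [← mul_assoc]
    exact (Nat.le_ceil _).trans (by exact_mod_cast le_max_right _ _)
  have hB2 : 720 * (B_F ^ 2 * L_G ^ 2) / μ ^ 2 ≤ (sockParams L L_F B_F L_G B_G μ).B := by
    rw [← mul_assoc]
    exact (Nat.le_ceil _).trans (by exact_mod_cast le_max_right _ _)
  refine ⟨rfl, rfl, rfl, ?_, ?_, ?_, by positivity, ?_, hμ, hLp, ?_, ?_, hA, hB,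
    div_batch_le hμ hA hA2, div_batch_le hμ hB hB2⟩
  · change 1 / (1 / (3 * (1 / (2 * (m : ℝ))) * L)) = _
    rw [one_div_one_div]
  · change 1 + 1 / (12 * (m : ℝ)) = _
    rw [div_div]
    ring_nf
  · rw [hm]
    field_simp
  · rw [div_le_div_iff₀ (by positivity) (by norm_num)]
    linarith
  · have h4 : L / μ ≤ 4 * (m : ℝ) ^ 2 := by
      rw [← hsq]
      nlinarith
    rw [div_le_iff₀ hμ] at h4
    rw [div_pow, one_pow, one_div, inv_mul_le_iff₀ (by positivity)]
    linarith
  · have h4 : (m : ℝ) ^ 2 ≤ L / μ := by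
      rw [← hsq]
      exact pow_le_pow_left₀ (by positivity) h2 2
    rw [le_div_iff₀ hμ] at h4
    have h5 : 4 * (1 / (2 * (m : ℝ))) ^ 2 * L = L / (m : ℝ) ^ 2 := by
      field_simp
      norm_num
    rw [h5, le_div_iff₀ (by positivity)]
    linarith

/-! ### One inner iteration -/

section

variable {N₁ N₂ n₁ n₂ : ℕ}

/-- The standing assumptions on the problem that a stage of NoCK solves, with minimiser `u`. -/
structure Problem.IsStage (Q : Problem N₁ N₂ n₁ n₂) (L L_F B_F L_G B_G μ : ℝ) (u : Vec N₂) :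
    Prop where
  convex : Q.IsConvex
  smooth : Q.SmoothBounded L_F B_F L_G B_G
  joint : Q.JointSmooth L
  minorant : Q.HasLinearMinorant
  strong : StrongConvexOn Q.dom μ Q.hReal
  mem_dom : u ∈ Q.dom
  isMin : ∀ w, Q.H u ≤ Q.H w

theorem _root_.ConvexOn.three_points {E : Type*} [AddCommGroup E] [Module ℝ E] {s : Set E}
    {f : E → ℝ} (hf : ConvexOn ℝ s f) {x y z : E} (hx : x ∈ s) (hy : y ∈ s) (hz : z ∈ s) {τ : ℝ}
    (h0 : 0 ≤ τ) (h1 : τ ≤ 1 / 2) :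
    τ • x + τ • y + (1 - τ - τ) • z ∈ s ∧
      f (τ • x + τ • y + (1 - τ - τ) • z) ≤ τ * f x + τ * f y + (1 - 2 * τ) * f z := by
  have hp : (1 / 2 : ℝ) • x + (1 / 2 : ℝ) • y ∈ s :=
    hf.1 hx hy (by norm_num) (by norm_num) (by norm_num)
  have hp' := hf.2 hx hy (by norm_num : (0 : ℝ) ≤ 1 / 2) (by norm_num : (0 : ℝ) ≤ 1 / 2)
    (by norm_num)
  have he : τ • x + τ • y + (1 - τ - τ) • z
      = (2 * τ) • ((1 / 2 : ℝ) • x + (1 / 2 : ℝ) • y) + (1 - 2 * τ) • z := by module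
  have h2 : 0 ≤ 1 - 2 * τ := by linarith
  have h3 := hf.2 hp hz (by linarith : 0 ≤ 2 * τ) h2 (by ring)
  rw [he]
  refine ⟨hf.1 hp hz (by linarith) h2 (by ring), h3.trans ?_⟩
  simp only [smul_eq_mul] at *
  nlinarith

variable {Q : Problem N₁ N₂ n₁ n₂} {L L_F B_F L_G B_G μ τ : ℝ} {u : Vec N₂}

theorem Problem.IsStage.strongConvexOn_HReal (hQ : Q.IsStage L L_F B_F L_G B_G μ u) :
    StrongConvexOn Q.dom μ Q.HReal := by
  have := hQ.strong.add_convexOn' (hQ.convex.f_convex.subset (Set.subset_univ _) hQ.strong.1)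
  refine ⟨this.1, fun x hx y hy a b ha hb hab => ?_⟩
  have := this.2 hx hy ha hb hab
  simp only [Problem.HReal, smul_eq_mul] at *
  linarith

theorem Problem.IsStage.growth (hQ : Q.IsStage L L_F B_F L_G B_G μ u) {x : Vec N₂}
    (hx : x ∈ Q.dom) : Q.HReal u + μ / 2 * ‖x - u‖ ^ 2 ≤ Q.HReal x :=
  hQ.strongConvexOn_HReal.growth hQ.mem_dom hx
    fun _ hw => hQ.convex.HReal_min hQ.isMin hQ.mem_dom hw

/-- The optimality of `y'` is tested at `v = τ z' + τ xs + (1 - 2τ) y`. Since `v - x = τ (z' - z)`,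
its quadratic term cancels against `τ` times the one in the optimality of `z'` tested at `u`. The
constant `3L` of the step to `y'` pays for `L/2` from the descent lemma and for `L` from Young's
inequality on the gradient error. Convexity of `f` at `u`, `xs` and `y` removes the remaining exact
gradient terms. -/
theorem step_inequality [NeZero n₁] [NeZero n₂]
    (hQ : Q.IsStage L L_F B_F L_G B_G μ u) (hμ : 0 ≤ μ) (hL : 0 < L)
    (h0 : 0 < τ) (h1 : τ ≤ 1 / 2) {xs y : Vec N₂} (hxs : xs ∈ Q.dom) (hy : y ∈ Q.dom)
    (z d x z' y' : Vec N₂) (hx : x = τ • z + τ • xs + (1 - τ - τ) • y)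
    (hz' : z' = Q.prox d (3 * τ * L) z) (hy' : y' = Q.prox d (3 * L) x) :
    Q.HReal y' - Q.HReal u + (3 * τ ^ 2 * L / 2 + τ * μ / 2) * ‖z' - u‖ ^ 2
      ≤ τ * (Q.HReal xs - Q.HReal u) + (1 - 2 * τ) * (Q.HReal y - Q.HReal u)
        + 3 * τ ^ 2 * L / 2 * ‖z - u‖ ^ 2 + τ * ⟪d - Q.gradf x, u - z⟫
        + ‖d - Q.gradf x‖ ^ 2 / (4 * L) := by
  have hconv : ConvexOn ℝ Q.dom Q.hReal := hQ.convex.convexOn_hReal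
  obtain ⟨hzd, hz⟩ := hQ.convex.prox_spec hQ.minorant hQ.strong d
    (by positivity : 0 < 3 * τ * L) z
  rw [← hz'] at hzd hz
  obtain ⟨hyd, hy1⟩ := hQ.convex.prox_spec hQ.minorant hQ.strong d
    (by positivity : 0 < 3 * L) x
  rw [← hy'] at hyd hy1
  obtain ⟨hvd, hv⟩ := hconv.three_points hzd hxs hy h0.le h1
  have hyv := hy1 _ hvd
  set v := τ • z' + τ • xs + (1 - τ - τ) • y with hvdef
  set g := Q.gradf x with hg
  have hvx : v - x = τ • (z' - z) := by rw [hvdef, hx]; module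
  have hnv : ‖v - x‖ ^ 2 = τ ^ 2 * ‖z' - z‖ ^ 2 := by
    rw [hvx, norm_smul, mul_pow, Real.norm_eq_abs, sq_abs]
  have hdv : ⟪d, v⟫ = ⟪d, x⟫ + τ * (⟪d, z'⟫ - ⟪d, z⟫) := by
    have : v = x + τ • (z' - z) := by rw [← hvx]; abel
    rw [this, inner_add_right, real_inner_smul_right, inner_sub_right]
  have hzu := hz u hQ.mem_dom
  rw [norm_sub_rev u z', norm_sub_rev u z] at hzu
  have hdesc := le_quadratic_of_lipschitz_gradient (fun x => hQ.smooth.hasGradientAt_f x)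
    hQ.joint.norm_gradf_sub_le x y'
  have hfu := hQ.convex.f_convex.inner_gradient_le (hQ.smooth.hasGradientAt_f x) u
  have hfs := hQ.convex.f_convex.inner_gradient_le (hQ.smooth.hasGradientAt_f x) xs
  have hfy := hQ.convex.f_convex.inner_gradient_le (hQ.smooth.hasGradientAt_f x) y
  rw [← hg] at hdesc hfu hfs hfy
  have hyoung : -⟪d - g, y' - x⟫ ≤ L * ‖y' - x‖ ^ 2 + ‖d - g‖ ^ 2 / (4 * L) := by
    have h2 := (abs_le.1 (abs_real_inner_le_norm (d - g) (y' - x))).1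
    have h3 : 0 ≤ (2 * L * ‖y' - x‖ - ‖d - g‖) ^ 2 / (4 * L) := by positivity
    have h4 : (2 * L * ‖y' - x‖ - ‖d - g‖) ^ 2 / (4 * L)
        = L * ‖y' - x‖ ^ 2 - ‖d - g‖ * ‖y' - x‖ + ‖d - g‖ ^ 2 / (4 * L) := by
      field_simp
      ring
    linarith
  have hcomb : τ * ⟪g, u - z⟫ = τ * ⟪g, u - x⟫ + τ * ⟪g, xs - x⟫ + (1 - 2 * τ) * ⟪g, y - x⟫ := by
    rw [← real_inner_smul_right, ← real_inner_smul_right, ← real_inner_smul_right,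
      ← real_inner_smul_right, ← inner_add_right, ← inner_add_right]
    congr 1
    rw [hx]
    module
  have e1 : ⟪d - g, y' - x⟫ = ⟪d, y'⟫ - ⟪d, x⟫ - ⟪g, y' - x⟫ := by
    rw [inner_sub_left, inner_sub_right]
  have e2 : τ * ⟪d - g, u - z⟫ = τ * (⟪d, u⟫ - ⟪d, z⟫) - τ * ⟪g, u - z⟫ := by
    rw [inner_sub_left, inner_sub_right]
    ring
  rw [e2, hcomb]
  rw [e1] at hyoung
  rw [hdv, hnv] at hyv
  have p1 : 0 ≤ (3 * L + μ) / 2 * ‖v - y'‖ ^ 2 := by positivity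
  have p2 := mul_le_mul_of_nonneg_left hzu h0.le
  have p3 := mul_le_mul_of_nonneg_left hfu h0.le
  have p4 := mul_le_mul_of_nonneg_left hfs h0.le
  have p5 := mul_le_mul_of_nonneg_left hfy (by linarith : 0 ≤ 1 - 2 * τ)
  simp only [Problem.HReal]
  linarith

/-- The weight of `‖z - u‖²` in the potential. -/
noncomputable def potWeight (L μ τ : ℝ) : ℝ := 3 * τ ^ 2 * L / 2 + τ * μ / 5

/-- The inequality of one inner iteration with the error of the gradient estimate isolated. -/
theorem step_inequality_error [NeZero n₁] [NeZero n₂] {q : Params}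
    (hQ : Q.IsStage L L_F B_F L_G B_G μ u)
    (hq : q.IsAdmissible L L_F B_F L_G B_G μ τ) {xs y : Vec N₂} (hxs : xs ∈ Q.dom)
    (hy : y ∈ Q.dom) (z d : Vec N₂) :
    Q.HReal (Q.prox d (3 * q.L) (queryPoint q xs z y)) - Q.HReal u
        + q.θ * potWeight L μ τ * ‖Q.prox d (1 / q.α) z - u‖ ^ 2
      ≤ τ * (Q.HReal xs - Q.HReal u) + (1 - 2 * τ) * (Q.HReal y - Q.HReal u)
        + (3 * τ ^ 2 * L / 2 + τ * μ / 6) * ‖z - u‖ ^ 2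
        + 2 * τ / μ * ‖d - Q.gradf (queryPoint q xs z y)‖ ^ 2 := by
  have h0 := hq.τ_pos
  have h1 := hq.τ_le
  have hμ := hq.μ_pos
  have hL := hq.L_pos
  have hsq := hq.sq_le
  have hsq2 := hq.le_sq
  have hstep := step_inequality hQ hμ.le hL h0 h1 hxs hy z d (queryPoint q xs z y)
    (Q.prox d (1 / q.α) z) (Q.prox d (3 * q.L) (queryPoint q xs z y))
    (by rw [queryPoint, hq.τ₁_eq, hq.τ₂_eq]) (by rw [hq.α_eq]) (by rw [hq.L_eq])
  set x := queryPoint q xs z y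
  set z' := Q.prox d (1 / q.α) z
  set δ := d - Q.gradf x
  -- Since `τ² L ≤ μ` and `τ ≤ 1/2`, the factor `θ = 1 + τ/6` adds at most `τμ/4 + τμ/60`; with the
  -- `τμ/5` of the weight this stays below `τμ/2`.
  have hw : q.θ * potWeight L μ τ ≤ 3 * τ ^ 2 * L / 2 + τ * μ / 2 := by
    rw [hq.θ_eq, potWeight]
    have h2 := mul_le_mul_of_nonneg_left hsq h0.le
    have h3 : τ * (τ * μ) ≤ 1 / 2 * (τ * μ) := mul_le_mul_of_nonneg_right h1 (by positivity)
    have h4 : 0 < τ * μ := by positivity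
    nlinarith
  have hw' := mul_le_mul_of_nonneg_right hw (sq_nonneg ‖z' - u‖)
  have hyoung : τ * ⟪δ, u - z⟫ ≤ τ * μ / 6 * ‖z - u‖ ^ 2 + 3 * τ / (2 * μ) * ‖δ‖ ^ 2 := by
    have h2 := real_inner_le_norm δ (u - z)
    rw [norm_sub_rev u z] at h2
    have h3 : 0 ≤ τ * (μ * ‖z - u‖ - 3 * ‖δ‖) ^ 2 / (6 * μ) := by positivity
    have h4 : τ * (μ * ‖z - u‖ - 3 * ‖δ‖) ^ 2 / (6 * μ)
        = τ * μ / 6 * ‖z - u‖ ^ 2 - τ * (‖δ‖ * ‖z - u‖) + 3 * τ / (2 * μ) * ‖δ‖ ^ 2 := by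
      field_simp
      ring
    have := mul_le_mul_of_nonneg_left h2 h0.le
    linarith
  -- Here `μ ≤ 4τ² L ≤ 2τL`.
  have hδ : ‖δ‖ ^ 2 / (4 * L) ≤ τ / (2 * μ) * ‖δ‖ ^ 2 := by
    rw [div_eq_inv_mul]
    refine mul_le_mul_of_nonneg_right ?_ (sq_nonneg _)
    rw [inv_eq_one_div, div_le_div_iff₀ (by positivity) (by positivity)]
    have : τ * (τ * L) ≤ 1 / 2 * (τ * L) := mul_le_mul_of_nonneg_right h1 (by positivity)
    nlinarith
  have hsum : 2 * τ / μ * ‖δ‖ ^ 2 = 3 * τ / (2 * μ) * ‖δ‖ ^ 2 + τ / (2 * μ) * ‖δ‖ ^ 2 := by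
    field_simp
    ring
  linarith

/-- The batch sizes make the error term at most `(2τ/μ)(μ²/180) = τμ/90` times `‖x - xs‖²`. Passing
through `u` and using quadratic growth, it costs at most `τ/20` of each gap, which explains `21/20`
and `39/20`; the part in `‖z - u‖²` fits into the slack between `τμ/6` and `τμ/5`. -/
theorem expect_step_le [NeZero n₁] [NeZero n₂] {q : Params} (hQ : Q.IsStage L L_F B_F L_G B_G μ u)
    (hq : q.IsAdmissible L L_F B_F L_G B_G μ τ) {xs y : Vec N₂} (hxs : xs ∈ Q.dom)
    (hy : y ∈ Q.dom) (z : Vec N₂) :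
    Finset.univ.expect (fun a : Fin q.A → Fin n₂ => Finset.univ.expect fun b : Fin q.B → Fin n₂ =>
      (Q.HReal (Q.prox (estGrad Q xs (queryPoint q xs z y) a b) (3 * q.L) (queryPoint q xs z y))
        - Q.HReal u + q.θ * potWeight L μ τ *
          ‖Q.prox (estGrad Q xs (queryPoint q xs z y) a b) (1 / q.α) z - u‖ ^ 2))
      ≤ 21 / 20 * τ * (Q.HReal xs - Q.HReal u)
        + (1 - 39 / 20 * τ) * (Q.HReal y - Q.HReal u) + potWeight L μ τ * ‖z - u‖ ^ 2 := by
  have h0 := hq.τ_pos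
  have h1 := hq.τ_le
  have hμ := hq.μ_pos
  refine (Finset.expect_le_expect fun a _ => Finset.expect_le_expect fun b _ =>
    step_inequality_error hQ hq hxs hy z (estGrad Q xs (queryPoint q xs z y) a b)).trans ?_
  simp only [Finset.expect_add_distrib, ← Finset.mul_expect, Fintype.expect_const]
  have hvar := expect_norm_estGrad_sub_sq_le hQ.smooth hq.A_pos hq.B_pos xs
    (queryPoint q xs z y)
  have hD : ‖queryPoint q xs z y - xs‖ ^ 2 ≤ τ * ‖z - xs‖ ^ 2 + (1 - 2 * τ) * ‖y - xs‖ ^ 2 := by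
    rw [queryPoint, hq.τ₁_eq, hq.τ₂_eq]
    exact norm_three_combo_sub_sq_le z xs y h0.le h1
  have hDz := mul_le_mul_of_nonneg_left (norm_sub_sq_le_two_mul z xs u) h0.le
  have hDy := mul_le_mul_of_nonneg_left (norm_sub_sq_le_two_mul y xs u)
    (by linarith : 0 ≤ 1 - 2 * τ)
  have hgs := hQ.growth hxs
  have hgy := hQ.growth hy
  have hAB : 2 * (B_G ^ 4 * L_F ^ 2 / q.A + B_F ^ 2 * L_G ^ 2 / q.B) ≤ μ ^ 2 / 180 := by
    have := hq.A_bound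
    have := hq.B_bound
    linarith
  have hAB' := mul_le_mul_of_nonneg_right hAB (sq_nonneg ‖queryPoint q xs z y - xs‖)
  have hE := mul_le_mul_of_nonneg_left (hvar.trans hAB')
    (by positivity : 0 ≤ 2 * τ / μ)
  have hE' : 2 * τ / μ * (μ ^ 2 / 180 * ‖queryPoint q xs z y - xs‖ ^ 2)
      = τ * μ / 90 * ‖queryPoint q xs z y - xs‖ ^ 2 := by
    field_simp
    ring
  rw [hE'] at hE
  have hD' := mul_le_mul_of_nonneg_left (hD.trans (add_le_add hDz hDy))
    (by positivity : 0 ≤ τ * μ / 90)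
  have hΔs : μ * ‖xs - u‖ ^ 2 ≤ 2 * (Q.HReal xs - Q.HReal u) := by linarith
  have hΔy : μ * ‖y - u‖ ^ 2 ≤ 2 * (Q.HReal y - Q.HReal u) := by linarith
  have hΔs0 : 0 ≤ Q.HReal xs - Q.HReal u :=
    sub_nonneg.2 (hQ.convex.HReal_min hQ.isMin hQ.mem_dom hxs)
  have hΔy0 : 0 ≤ Q.HReal y - Q.HReal u :=
    sub_nonneg.2 (hQ.convex.HReal_min hQ.isMin hQ.mem_dom hy)
  have b1 : τ * μ / 90 * (2 * (1 - τ) * ‖xs - u‖ ^ 2)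
      ≤ τ / 90 * (4 * (1 - τ)) * (Q.HReal xs - Q.HReal u) := by
    have := mul_le_mul_of_nonneg_left hΔs
      (mul_nonneg (by positivity : 0 ≤ τ / 90) (by linarith : 0 ≤ 2 * (1 - τ)))
    linarith
  have b2 : τ * μ / 90 * (2 * (1 - 2 * τ) * ‖y - u‖ ^ 2)
      ≤ τ / 90 * (4 * (1 - 2 * τ)) * (Q.HReal y - Q.HReal u) := by
    have := mul_le_mul_of_nonneg_left hΔy
      (mul_nonneg (by positivity : 0 ≤ τ / 90) (by linarith : 0 ≤ 2 * (1 - 2 * τ)))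
    linarith
  have b3 : τ * μ / 90 * (2 * τ * ‖z - u‖ ^ 2) ≤ τ * μ / 90 * ‖z - u‖ ^ 2 :=
    mul_le_mul_of_nonneg_left
      (mul_le_of_le_one_left (sq_nonneg _) (by linarith)) (by positivity)
  have c1 : τ / 90 * (4 * (1 - τ)) * (Q.HReal xs - Q.HReal u)
      ≤ τ / 20 * (Q.HReal xs - Q.HReal u) :=
    mul_le_mul_of_nonneg_right (by nlinarith) hΔs0
  have c2 : τ / 90 * (4 * (1 - 2 * τ)) * (Q.HReal y - Q.HReal u)
      ≤ τ / 20 * (Q.HReal y - Q.HReal u) :=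
    mul_le_mul_of_nonneg_right (by nlinarith) hΔy0
  have c3 : 0 ≤ τ * μ * ‖z - u‖ ^ 2 := by positivity
  rw [potWeight]
  linarith

end

section

variable {N₁ N₂ n₁ n₂ : ℕ} {Q : Problem N₁ N₂ n₁ n₂} {L L_F B_F L_G B_G μ τ : ℝ} {u : Vec N₂}

/-! ### The optimality gap as an extended nonnegative function -/

theorem Problem.IsStage.gap_eq (hQ : Q.IsStage L L_F B_F L_G B_G μ u) {x : Vec N₂}
    (hx : x ∈ Q.dom) : Q.gap x = ENNReal.ofReal (Q.HReal x - Q.HReal u) :=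
  hQ.convex.gap_eq hQ.isMin hQ.mem_dom hx

theorem Problem.IsStage.gap_eq_top (hQ : Q.IsStage L L_F B_F L_G B_G μ u) {x : Vec N₂}
    (hx : x ∉ Q.dom) : Q.gap x = ⊤ :=
  hQ.convex.gap_eq_top hQ.isMin hQ.mem_dom hx

theorem Problem.IsStage.HReal_sub_nonneg (hQ : Q.IsStage L L_F B_F L_G B_G μ u) {x : Vec N₂}
    (hx : x ∈ Q.dom) : 0 ≤ Q.HReal x - Q.HReal u :=
  sub_nonneg.2 (hQ.convex.HReal_min hQ.isMin hQ.mem_dom hx)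

theorem ofReal_mul_top_add {a : ℝ} (ha : 0 < a) (b : ENNReal) : ENNReal.ofReal a * ⊤ + b = ⊤ := by
  rw [ENNReal.mul_top (by simpa using ha), top_add]

theorem Problem.IsStage.gap_combo_le (hQ : Q.IsStage L L_F B_F L_G B_G μ u) (hμ : 0 ≤ μ)
    (x y : Vec N₂) {a b : ℝ} (ha : 0 < a) (hb : 0 < b) (hab : a + b = 1) :
    Q.gap (a • x + b • y) ≤ ENNReal.ofReal a * Q.gap x + ENNReal.ofReal b * Q.gap y := by
  by_cases hx : x ∈ Q.dom
  swap
  · rw [hQ.gap_eq_top hx, ofReal_mul_top_add ha]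
    exact le_top
  by_cases hy : y ∈ Q.dom
  swap
  · rw [hQ.gap_eq_top hy, add_comm (ENNReal.ofReal a * _), ofReal_mul_top_add hb]
    exact le_top
  have hc : ConvexOn ℝ Q.dom Q.HReal := by simpa using hQ.strongConvexOn_HReal.mono hμ
  have h := hc.2 hx hy ha.le hb.le hab
  have hx0 := hQ.HReal_sub_nonneg hx
  have hy0 := hQ.HReal_sub_nonneg hy
  rw [hQ.gap_eq hx, hQ.gap_eq hy, hQ.gap_eq (hc.1 hx hy ha.le hb.le hab),
    ← ENNReal.ofReal_mul ha.le, ← ENNReal.ofReal_mul hb.le,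
    ← ENNReal.ofReal_add (by positivity) (by positivity)]
  apply ENNReal.ofReal_le_ofReal
  obtain rfl : b = 1 - a := by linarith
  simp only [smul_eq_mul] at h
  linarith

open Classical in
/-- The perspective of the gap: `W` times the gap at the average `W⁻¹ • acc`. -/
noncomputable def Problem.gapPersp (Q : Problem N₁ N₂ n₁ n₂) (W : ℝ) (acc : Vec N₂) : ENNReal :=
  if W = 0 then (if acc = 0 then 0 else ⊤) else ENNReal.ofReal W * Q.gap (W⁻¹ • acc)

/-- The perspective of a convex function is subadditive. The convention at `W = 0` lets the
accumulator start from the empty sum. -/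
theorem Problem.IsStage.gapPersp_add_le (hQ : Q.IsStage L L_F B_F L_G B_G μ u) (hμ : 0 ≤ μ)
    {W t : ℝ} (hW : 0 ≤ W) (ht : 0 < t) (acc y : Vec N₂) :
    Q.gapPersp (W + t) (acc + t • y) ≤ Q.gapPersp W acc + ENNReal.ofReal t * Q.gap y := by
  unfold Problem.gapPersp
  rw [if_neg (by positivity)]
  by_cases h0 : W = 0
  · rw [if_pos h0]
    split_ifs with hacc
    · simp [h0, hacc, smul_smul, ht.ne']
    · simp
  · have hWp : 0 < W := lt_of_le_of_ne hW (Ne.symm h0)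
    rw [if_neg h0]
    have he : (W + t)⁻¹ • (acc + t • y) = (W / (W + t)) • (W⁻¹ • acc) + (t / (W + t)) • y := by
      rw [smul_add, smul_smul, smul_smul]
      congr 2
      · field_simp
      · field_simp
    rw [he]
    refine (mul_le_mul_right (hQ.gap_combo_le hμ (W⁻¹ • acc) y (a := W / (W + t))
      (b := t / (W + t)) (by positivity) (by positivity) (by field_simp)) _).trans ?_
    rw [mul_add, ← mul_assoc, ← mul_assoc, ← ENNReal.ofReal_mul (by positivity),
      ← ENNReal.ofReal_mul (by positivity), mul_div_cancel₀ _ (by positivity),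
      mul_div_cancel₀ _ (by positivity)]

theorem mean_sockStep_le [NeZero n₁] [NeZero n₂] {q : Params}
    (hQ : Q.IsStage L L_F B_F L_G B_G μ u) (hq : q.IsAdmissible L L_F B_F L_G B_G μ τ)
    (xs z y : Vec N₂) (s : ℕ) :
    (sockStep Q q xs (Q.inner xs) (Q.jac xs) z y).mean
      (fun r => Q.gap r.2 + ENNReal.ofReal (q.θ * potWeight L μ τ * ‖r.1 - u‖ ^ 2)) s
      ≤ ENNReal.ofReal (21 / 20 * τ) * Q.gap xs + ENNReal.ofReal (1 - 39 / 20 * τ) * Q.gap y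
        + ENNReal.ofReal (potWeight L μ τ * ‖z - u‖ ^ 2) := by
  have h0 := hq.τ_pos
  have h1 := hq.τ_le
  have hμ := hq.μ_pos
  have hL := hq.L_pos
  -- Strict positivity, from `τ ≤ 1/2`, makes the right-hand side `⊤` when `y` lies outside the
  -- domain, so that case is trivial.
  have ha : 0 < 1 - 39 / 20 * τ := by linarith
  have hθ : 0 < q.θ := by rw [hq.θ_eq]; positivity
  have hw : 0 ≤ potWeight L μ τ := by rw [potWeight]; positivity
  by_cases hxs : xs ∈ Q.dom
  swap
  · rw [hQ.gap_eq_top hxs, ofReal_mul_top_add (by positivity), top_add]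
    exact le_top
  by_cases hy : y ∈ Q.dom
  swap
  · rw [hQ.gap_eq_top hy, add_right_comm, add_comm, ofReal_mul_top_add ha]
    exact le_top
  rw [mean_sockStep, hQ.gap_eq hxs, hQ.gap_eq hy]
  set x := queryPoint q xs z y with hx
  have hprox : ∀ d, Q.prox d (3 * q.L) x ∈ Q.dom := fun d =>
    (hQ.convex.prox_spec hQ.minorant hQ.strong d (by rw [hq.L_eq]; positivity) x).1
  have hpt : ∀ d, Q.gap (Q.prox d (3 * q.L) x)
      + ENNReal.ofReal (q.θ * potWeight L μ τ * ‖Q.prox d (1 / q.α) z - u‖ ^ 2)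
      = ENNReal.ofReal (Q.HReal (Q.prox d (3 * q.L) x) - Q.HReal u
        + q.θ * potWeight L μ τ * ‖Q.prox d (1 / q.α) z - u‖ ^ 2) := fun d => by
    rw [hQ.gap_eq (hprox d), ENNReal.ofReal_add (hQ.HReal_sub_nonneg (hprox d)) (by positivity)]
  have hnn : ∀ d, 0 ≤ Q.HReal (Q.prox d (3 * q.L) x) - Q.HReal u
      + q.θ * potWeight L μ τ * ‖Q.prox d (1 / q.α) z - u‖ ^ 2 := fun d =>
    add_nonneg (hQ.HReal_sub_nonneg (hprox d)) (by positivity)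
  simp only [hpt]
  simp_rw [expect_uniform_ofReal _ fun b => hnn (estGrad Q xs x _ b)]
  rw [expect_uniform_ofReal _ fun a => Finset.expect_nonneg fun b _ => hnn (estGrad Q xs x a b)]
  have hs0 := hQ.HReal_sub_nonneg hxs
  have hy0 := hQ.HReal_sub_nonneg hy
  rw [← ENNReal.ofReal_mul (by positivity), ← ENNReal.ofReal_mul ha.le,
    ← ENNReal.ofReal_add (by positivity) (by positivity),
    ← ENNReal.ofReal_add (by positivity) (by positivity)]
  exact ENNReal.ofReal_le_ofReal (expect_step_le hQ hq hxs hy z)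

/-! ### The inner and the outer loop -/

/-- The potential of the inner loop after `j` iterations. -/
noncomputable def innerPot (Q : Problem N₁ N₂ n₁ n₂) (q : Params) (L μ τ : ℝ) (u : Vec N₂) (j : ℕ)
    (r : Vec N₂ × Vec N₂ × Vec N₂) : ENNReal :=
  ENNReal.ofReal (1 - q.θ * (1 - 39 / 20 * τ))
      * Q.gapPersp (∑ i ∈ Finset.range j, q.θ ^ i) r.2.2
    + ENNReal.ofReal (q.θ ^ j) * (ENNReal.ofReal (1 - 39 / 20 * τ) * Q.gap r.2.1
      + ENNReal.ofReal (potWeight L μ τ * ‖r.1 - u‖ ^ 2))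

theorem Params.IsAdmissible.decrease {q : Params} (hq : q.IsAdmissible L L_F B_F L_G B_G μ τ) :
    13 / 12 * (21 / 20 * τ) ≤ 1 - q.θ * (1 - 39 / 20 * τ) := by
  rw [hq.θ_eq]
  nlinarith [hq.τ_pos, hq.τ_le]

/-- The weight of the accumulator is `κ = 1 - θ (1 - 39τ/20)`, chosen so that `κ θ^j + θ^(j+1) (1 -
39τ/20) = θ^j`: the two occurrences of the gap at `y'` merge into the left side of the one-step
bound. -/
theorem innerPot_succ_le (hQ : Q.IsStage L L_F B_F L_G B_G μ u) {q : Params}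
    (hq : q.IsAdmissible L L_F B_F L_G B_G μ τ) (j : ℕ) (z' y' acc : Vec N₂) :
    innerPot Q q L μ τ u (j + 1) (z', y', acc + q.θ ^ j • y')
      ≤ ENNReal.ofReal (1 - q.θ * (1 - 39 / 20 * τ))
          * Q.gapPersp (∑ i ∈ Finset.range j, q.θ ^ i) acc
        + ENNReal.ofReal (q.θ ^ j)
          * (Q.gap y' + ENNReal.ofReal (q.θ * potWeight L μ τ * ‖z' - u‖ ^ 2)) := by
  have h0 := hq.τ_pos
  have ha : 0 < 1 - 39 / 20 * τ := by linarith [hq.τ_le]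
  have hθ : 0 < q.θ := by rw [hq.θ_eq]; positivity
  have hκ : 0 < 1 - q.θ * (1 - 39 / 20 * τ) := lt_of_lt_of_le (by positivity) hq.decrease
  have hW : 0 ≤ ∑ i ∈ Finset.range j, q.θ ^ i := Finset.sum_nonneg fun i _ => by positivity
  unfold innerPot
  rw [Finset.sum_range_succ]
  refine (add_le_add_left (mul_le_mul_right
    (hQ.gapPersp_add_le hq.μ_pos.le hW (by positivity) acc y') _) _).trans (le_of_eq ?_)
  simp only [mul_add, mul_assoc, pow_succ, ENNReal.ofReal_mul hθ.le,
    ENNReal.ofReal_mul (pow_pos hθ j).le, add_assoc]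
  congr 1
  rw [← add_assoc]
  congr 1
  rw [mul_left_comm, ← mul_add, ← mul_assoc, ← add_mul, ← ENNReal.ofReal_mul hθ.le,
    ← ENNReal.ofReal_add hκ.le (by positivity)]
  simp

/-- Telescoping: the step `j` adds only the snapshot term `θ^j (21/20) τ` times the gap at `xs`. -/
theorem mean_sockInner_le [NeZero n₁] [NeZero n₂] {q : Params}
    (hQ : Q.IsStage L L_F B_F L_G B_G μ u) (hq : q.IsAdmissible L L_F B_F L_G B_G μ τ)
    (xs z y : Vec N₂) (j s : ℕ) :
    (sockInner Q q xs (Q.inner xs) (Q.jac xs) z y j).mean (innerPot Q q L μ τ u j) s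
      ≤ ENNReal.ofReal ((∑ i ∈ Finset.range j, q.θ ^ i) * (21 / 20 * τ)) * Q.gap xs
        + (ENNReal.ofReal (1 - 39 / 20 * τ) * Q.gap y
          + ENNReal.ofReal (potWeight L μ τ * ‖z - u‖ ^ 2)) := by
  have h0 := hq.τ_pos
  have hθ : 0 < q.θ := by rw [hq.θ_eq]; positivity
  induction j with
  | zero =>
    refine (Comp.mean_pure _ _ _).le.trans ?_
    simp [innerPot, Problem.gapPersp]
  | succ j ih =>
    refine (mean_sockInner_succ_le Q q xs _ _ z y j _
      (fun r => ENNReal.ofReal (q.θ ^ j * (21 / 20 * τ)) * Q.gap xs + innerPot Q q L μ τ u j r)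
      (fun r s => ?_) s).trans ?_
    · have h1 := Comp.mean_mono (sockStep Q q xs (Q.inner xs) (Q.jac xs) r.1 r.2.1)
        (φ := fun r' => innerPot Q q L μ τ u (j + 1) (r'.1, r'.2, r.2.2 + q.θ ^ j • r'.2))
        (ψ := fun r' => ENNReal.ofReal (1 - q.θ * (1 - 39 / 20 * τ))
            * Q.gapPersp (∑ i ∈ Finset.range j, q.θ ^ i) r.2.2
          + ENNReal.ofReal (q.θ ^ j)
            * (Q.gap r'.2 + ENNReal.ofReal (q.θ * potWeight L μ τ * ‖r'.1 - u‖ ^ 2)))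
        (fun r' => innerPot_succ_le hQ hq j r'.1 r'.2 r.2.2) s
      refine h1.trans ?_
      rw [Comp.mean_const_add, Comp.mean_const_mul]
      have h2 := mul_le_mul_right (mean_sockStep_le hQ hq xs r.1 r.2.1 s)
        (ENNReal.ofReal (q.θ ^ j))
      refine (add_le_add_right h2 _).trans (le_of_eq ?_)
      rw [innerPot, ENNReal.ofReal_mul (p := q.θ ^ j) (q := 21 / 20 * τ) (by positivity)]
      ring
    · rw [Comp.mean_const_add]
      refine (add_le_add_right ih _).trans (le_of_eq ?_)
      have hW : 0 ≤ ∑ i ∈ Finset.range j, q.θ ^ i := Finset.sum_nonneg fun i _ => by positivity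
      rw [Finset.sum_range_succ, add_mul, ENNReal.ofReal_add (by positivity) (by positivity)]
      ring

/-- The potential of the outer loop. -/
noncomputable def outerPot (Q : Problem N₁ N₂ n₁ n₂) (q : Params) (L μ τ : ℝ) (u : Vec N₂)
    (r : Vec N₂ × Vec N₂ × Vec N₂) : ENNReal :=
  ENNReal.ofReal ((∑ i ∈ Finset.range q.m, q.θ ^ i) * (21 / 20 * τ)) * Q.gap r.1
    + (ENNReal.ofReal (1 - 39 / 20 * τ) * Q.gap r.2.2
      + ENNReal.ofReal (potWeight L μ τ * ‖r.2.1 - u‖ ^ 2))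

theorem Params.IsAdmissible.m_le_sum {q : Params} (hq : q.IsAdmissible L L_F B_F L_G B_G μ τ) :
    (q.m : ℝ) ≤ ∑ i ∈ Finset.range q.m, q.θ ^ i := by
  have h1 : 1 ≤ q.θ := by rw [hq.θ_eq]; linarith [hq.τ_pos]
  calc (q.m : ℝ) = ∑ _i ∈ Finset.range q.m, 1 := by simp
    _ ≤ _ := Finset.sum_le_sum fun i _ => one_le_pow₀ h1

theorem Params.IsAdmissible.m_pos {q : Params} (hq : q.IsAdmissible L L_F B_F L_G B_G μ τ) :
    (0 : ℝ) < q.m := by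
  have := hq.m_mul
  have := hq.τ_pos
  by_contra! h
  nlinarith

/-- Bernoulli's inequality, with `m τ / 6 = 1/12`. -/
theorem Params.IsAdmissible.le_pow {q : Params} (hq : q.IsAdmissible L L_F B_F L_G B_G μ τ) :
    13 / 12 ≤ q.θ ^ q.m := by
  have h := one_add_mul_le_pow (a := τ / 6) (by linarith [hq.τ_pos]) q.m
  rw [← hq.θ_eq] at h
  linarith [hq.m_mul]

/-- Both parts of the potential gain `13/12`: the averaged gap through `decrease`, the rest through
`θ^m ≥ 13/12`. -/
theorem outerPot_le {q : Params} (hq : q.IsAdmissible L L_F B_F L_G B_G μ τ)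
    (w : Vec N₂ × Vec N₂ × Vec N₂) :
    outerPot Q q L μ τ u ((∑ j ∈ Finset.range q.m, q.θ ^ j)⁻¹ • w.2.2, w.1, w.2.1)
      ≤ ENNReal.ofReal (12 / 13) * innerPot Q q L μ τ u q.m w := by
  have h0 := hq.τ_pos
  have hd := hq.decrease
  have hm := hq.m_pos
  have hmW := hq.m_le_sum
  have hp := hq.le_pow
  set W := ∑ i ∈ Finset.range q.m, q.θ ^ i with hW
  have hWp : 0 < W := by linarith
  unfold outerPot innerPot Problem.gapPersp
  rw [← hW, if_neg hWp.ne', mul_add]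
  refine add_le_add ?_ ?_
  · have hκ : 0 ≤ 12 / 13 * (1 - q.θ * (1 - 39 / 20 * τ)) :=
      mul_nonneg (by norm_num) (le_trans (by positivity) hd)
    rw [← mul_assoc (ENNReal.ofReal (12 / 13)), ← mul_assoc (ENNReal.ofReal (12 / 13) * _),
      ← ENNReal.ofReal_mul (by norm_num), ← ENNReal.ofReal_mul hκ]
    refine mul_le_mul_left (ENNReal.ofReal_le_ofReal ?_) _
    have := mul_le_mul_of_nonneg_right hd hWp.le
    linarith
  · rw [← mul_assoc, ← ENNReal.ofReal_mul (by positivity)]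
    refine le_mul_of_one_le_left zero_le ?_
    rw [← ENNReal.ofReal_one]
    exact ENNReal.ofReal_le_ofReal (by linarith)

theorem mean_sockOuter_le [NeZero n₁] [NeZero n₂] {q : Params}
    (hQ : Q.IsStage L L_F B_F L_G B_G μ u) (hq : q.IsAdmissible L L_F B_F L_G B_G μ τ)
    (x : Vec N₂) (k s : ℕ) :
    (sockOuter Q q x k).mean (outerPot Q q L μ τ u) s
      ≤ ENNReal.ofReal (12 / 13) ^ k * outerPot Q q L μ τ u (x, x, x) := by
  induction k with
  | zero =>
    refine (Comp.mean_pure _ _ _).le.trans ?_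
    simp
  | succ k ih =>
    refine (mean_sockOuter_succ_le Q q x k _
      (fun r => ENNReal.ofReal (12 / 13) * outerPot Q q L μ τ u r) (fun r s => ?_) s).trans ?_
    · refine (Comp.mean_mono _ (fun w => outerPot_le hq w) s).trans ?_
      rw [Comp.mean_const_mul]
      exact mul_le_mul_right (mean_sockInner_le hQ hq r.1 r.2.1 r.2.2 q.m s) _
    · rw [Comp.mean_const_mul, pow_succ', mul_assoc]
      exact mul_le_mul_right ih _

/-- Let `W` be the sum of the `θ^i`. As `W τ ≥ 1/2`, the snapshot term alone controls the gap, and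
growth bounds the distance term by `16/5` of the gap; the factor `10` covers everything. -/
theorem outerPot_diag_le (hQ : Q.IsStage L L_F B_F L_G B_G μ u) {q : Params}
    (hq : q.IsAdmissible L L_F B_F L_G B_G μ τ) (x : Vec N₂) :
    outerPot Q q L μ τ u (x, x, x)
      ≤ ENNReal.ofReal ((∑ i ∈ Finset.range q.m, q.θ ^ i) * (21 / 20 * τ))
        * (ENNReal.ofReal 10 * Q.gap x) := by
  have h0 := hq.τ_pos
  have h1 := hq.τ_le
  have hμ := hq.μ_pos
  have hL := hq.L_pos
  have hmW := hq.m_le_sum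
  have hm := hq.m_pos
  have hm2 := hq.m_mul
  have ha : 0 ≤ 1 - 39 / 20 * τ := by linarith
  have hw : 0 ≤ potWeight L μ τ := by rw [potWeight]; positivity
  unfold outerPot
  set W := ∑ i ∈ Finset.range q.m, q.θ ^ i
  have hW : 0 < W := by linarith
  by_cases hx : x ∈ Q.dom
  swap
  · have h10 : ENNReal.ofReal 10 ≠ 0 := by simp
    have hc : ENNReal.ofReal (W * (21 / 20 * τ)) ≠ 0 := by
      simpa using (by positivity : 0 < W * (21 / 20 * τ))
    rw [hQ.gap_eq_top hx, ENNReal.mul_top h10, ENNReal.mul_top hc]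
    exact le_top
  have hx0 := hQ.HReal_sub_nonneg hx
  have hg := hQ.growth hx
  simp only [hQ.gap_eq hx]
  rw [← ENNReal.ofReal_mul (by positivity), ← ENNReal.ofReal_mul ha,
    ← ENNReal.ofReal_mul (by norm_num), ← ENNReal.ofReal_mul (by positivity),
    ← ENNReal.ofReal_add (by positivity) (by positivity),
    ← ENNReal.ofReal_add (by positivity) (by positivity)]
  apply ENNReal.ofReal_le_ofReal
  set D := Q.HReal x - Q.HReal u with hD
  have hWτ : 1 / 2 ≤ W * τ := by
    rw [← hm2]
    exact mul_le_mul_of_nonneg_right hmW h0.le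
  have hpw : potWeight L μ τ ≤ 8 / 5 * μ := by
    have := hq.sq_le
    rw [potWeight]
    nlinarith
  have b1 := mul_le_mul_of_nonneg_right hpw (sq_nonneg ‖x - u‖)
  have b2 := mul_le_mul_of_nonneg_right hWτ hx0
  have b3 : 0 ≤ τ * D := by positivity
  have b4 : μ * ‖x - u‖ ^ 2 ≤ 2 * D := by rw [hD]; linarith
  nlinarith

/-- `64` outer loops of SoCK reduce the expected gap by the factor `12`. -/
theorem mean_sock_gap_le [NeZero n₁] [NeZero n₂] {q : Params}
    (hQ : Q.IsStage L L_F B_F L_G B_G μ u) (hq : q.IsAdmissible L L_F B_F L_G B_G μ τ)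
    (x : Vec N₂) (s : ℕ) :
    (sock Q q 64 x).mean Q.gap s ≤ ENNReal.ofReal (1 / 12) * Q.gap x := by
  have h0 := hq.τ_pos
  have hm := hq.m_pos
  have hmW := hq.m_le_sum
  set c := ENNReal.ofReal ((∑ i ∈ Finset.range q.m, q.θ ^ i) * (21 / 20 * τ)) with hc
  have hc0 : c ≠ 0 := by
    have : 0 < ∑ i ∈ Finset.range q.m, q.θ ^ i := by linarith
    simpa [hc] using (by positivity : 0 < (∑ i ∈ Finset.range q.m, q.θ ^ i) * (21 / 20 * τ))
  have hct : c ≠ ⊤ := ENNReal.ofReal_ne_top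
  refine (mean_sock_le Q q 64 x _ s).trans ?_
  -- Both sides are scaled by the snapshot weight of the potential, whose other terms can then be
  -- dropped at the end of the run.
  refine (ENNReal.mul_le_mul_iff_right hc0 hct).1 ?_
  rw [← Comp.mean_const_mul]
  refine (Comp.mean_mono _ (ψ := outerPot Q q L μ τ u) (fun r => le_self_add) s).trans ?_
  refine (mean_sockOuter_le hQ hq x 64 s).trans ?_
  refine (mul_le_mul_right (outerPot_diag_le hQ hq x) _).trans ?_
  rw [mul_left_comm, ← mul_assoc (ENNReal.ofReal (12 / 13) ^ 64),
    ← ENNReal.ofReal_pow (by norm_num),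
    ← ENNReal.ofReal_mul (by norm_num)]
  refine mul_le_mul_right (mul_le_mul_left (ENNReal.ofReal_le_ofReal ?_) _) _
  norm_num

end

section

variable {N₁ N₂ n₁ n₂ : ℕ} {P : Problem N₁ N₂ n₁ n₂} {L L_F B_F L_G B_G : ℝ}

/-! ### Comparison of the regularised problems -/

theorem Problem.IsConvex.isStage_regularize [NeZero n₁] [NeZero n₂] (hP : P.IsConvex)
    (hs : P.SmoothBounded L_F B_F L_G B_G) (hJ : P.JointSmooth L) {xstar : Vec N₂}
    (hmin : ∀ x, P.H xstar ≤ P.H x) {μ : ℝ} (hμ : 0 < μ) (x₀ : Vec N₂) :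
    ∃ u, (P.regularize μ x₀).IsStage L L_F B_F L_G B_G μ u := by
  obtain ⟨u, hud, hu⟩ := hs.exists_isMin_regularize hP hmin hμ x₀
  refine ⟨u, hP.regularize hμ.le x₀, ?_, hJ, (hs.hasLinearMinorant hP hmin).regularize hP hμ.le x₀,
    hP.strongConvexOn_regularize μ x₀, ?_, hu⟩
  · exact ⟨hs.L_F_nonneg, hs.L_G_nonneg, hs.F_diff, hs.F_smooth, hs.F_bound, hs.G_diff,
      hs.G_smooth, hs.G_bound⟩
  · rwa [Problem.dom_regularize]

/-- The only loss is `(μ/4) ‖v - x₀‖²` when the minimum of `H_μ` is compared with that of `H_{μ/2}`;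
and `v` is no farther from `x₀` than `xstar` is, because `xstar` minimises `H`. -/
theorem gap_regularize_half_le (hP : P.IsConvex) {xstar : Vec N₂}
    (hmin : ∀ x, P.H xstar ≤ P.H x) {μ D_x : ℝ} (hμ : 0 < μ) {x₀ u v : Vec N₂}
    (hD : ‖x₀ - xstar‖ ^ 2 ≤ D_x)
    (hu : (P.regularize μ x₀).IsStage L L_F B_F L_G B_G μ u)
    (hv : (P.regularize (μ / 2) x₀).IsStage L L_F B_F L_G B_G (μ / 2) v) (x : Vec N₂) :
    (P.regularize (μ / 2) x₀).gap x
      ≤ ENNReal.ofReal (μ * D_x / 4) + (P.regularize μ x₀).gap x := by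
  have hsd := Problem.mem_dom_of_isMin hP hmin
  have hud := hu.mem_dom
  have hvd := hv.mem_dom
  rw [Problem.dom_regularize] at hud hvd
  by_cases hx : x ∈ P.dom
  swap
  · rw [hu.gap_eq_top (by rwa [Problem.dom_regularize]), add_top]
    exact le_top
  have hDx : 0 ≤ D_x := (sq_nonneg _).trans hD
  have h1 := hu.HReal_sub_nonneg (x := v) (by rwa [Problem.dom_regularize])
  have h2 := hu.HReal_sub_nonneg (x := x) (by rwa [Problem.dom_regularize])
  have h3 := hv.HReal_sub_nonneg (x := xstar) (by rwa [Problem.dom_regularize])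
  have h4 := hP.HReal_min hmin hsd hvd
  rw [hu.gap_eq (by rwa [Problem.dom_regularize]), hv.gap_eq (by rwa [Problem.dom_regularize]),
    ← ENNReal.ofReal_add (by positivity) h2]
  apply ENNReal.ofReal_le_ofReal
  rw [hP.HReal_regularize _ _ hx, hP.HReal_regularize _ _ hud] at h2 ⊢
  rw [hP.HReal_regularize _ _ hvd, hP.HReal_regularize _ _ hud] at h1
  rw [hP.HReal_regularize _ _ hsd, hP.HReal_regularize _ _ hvd, norm_sub_rev xstar] at h3
  rw [hP.HReal_regularize _ _ hx, hP.HReal_regularize _ _ hvd]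
  have h5 : 0 ≤ μ / 4 * ‖x - x₀‖ ^ 2 := by positivity
  have h6 := mul_le_mul_of_nonneg_left hD hμ.le
  linarith

/-- The regulariser vanishes at `x₀` and is nonnegative elsewhere. -/
theorem gap_regularize_start_le (hP : P.IsConvex) {xstar : Vec N₂}
    (hmin : ∀ x, P.H xstar ≤ P.H x) {μ D_H : ℝ} (hμ : 0 ≤ μ) {x₀ u : Vec N₂} (hx₀ : x₀ ∈ P.dom)
    (hD : P.HReal x₀ - P.HReal xstar ≤ D_H)
    (hu : (P.regularize μ x₀).IsStage L L_F B_F L_G B_G μ u) :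
    (P.regularize μ x₀).gap x₀ ≤ ENNReal.ofReal D_H := by
  have hud := hu.mem_dom
  rw [Problem.dom_regularize] at hud
  rw [hu.gap_eq (by rwa [Problem.dom_regularize])]
  apply ENNReal.ofReal_le_ofReal
  rw [hP.HReal_regularize _ _ hx₀, hP.HReal_regularize _ _ hud, sub_self, norm_zero]
  have h1 := hP.HReal_min hmin (Problem.mem_dom_of_isMin hP hmin) hud
  have h2 : 0 ≤ μ / 2 * ‖u - x₀‖ ^ 2 := by positivity
  linarith

/-- The plain comparison has bias `μ D_x/2`, which would use up the whole accuracy at the last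
stage. Keeping the negative terms `‖x - x₀‖²` and `‖xstar - u‖²` and applying the triangle
inequality to `x₀, x, u, xstar` lowers the bias to `μ D_x/3`, at the price of `(μ/2) ‖x - u‖²`, that
is, of a second copy of the gap. -/
theorem gap_le_gap_regularize (hP : P.IsConvex) {xstar : Vec N₂}
    (hmin : ∀ x, P.H xstar ≤ P.H x) {μ D_x : ℝ} (hμ : 0 < μ) {x₀ u : Vec N₂}
    (hD : ‖x₀ - xstar‖ ^ 2 ≤ D_x)
    (hu : (P.regularize μ x₀).IsStage L L_F B_F L_G B_G μ u) (x : Vec N₂) :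
    P.gap x ≤ ENNReal.ofReal (μ * D_x / 3) + ENNReal.ofReal 2 * (P.regularize μ x₀).gap x := by
  have hsd := Problem.mem_dom_of_isMin hP hmin
  have hud := hu.mem_dom
  rw [Problem.dom_regularize] at hud
  by_cases hx : x ∈ P.dom
  swap
  · rw [hu.gap_eq_top (by rwa [Problem.dom_regularize]), ENNReal.mul_top (by simp), add_top]
    exact le_top
  have hDx : 0 ≤ D_x := (sq_nonneg _).trans hD
  have h2 := hu.HReal_sub_nonneg (x := x) (by rwa [Problem.dom_regularize])
  have h1 := hu.growth (x := x) (by rwa [Problem.dom_regularize])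
  have h3 := hu.growth (x := xstar) (by rwa [Problem.dom_regularize])
  rw [hu.gap_eq (by rwa [Problem.dom_regularize]), hP.gap_eq hmin hsd hx,
    ← ENNReal.ofReal_mul (by norm_num), ← ENNReal.ofReal_add (by positivity) (by positivity)]
  apply ENNReal.ofReal_le_ofReal
  rw [hP.HReal_regularize _ _ hx, hP.HReal_regularize _ _ hud] at h1 ⊢
  rw [hP.HReal_regularize _ _ hsd, hP.HReal_regularize _ _ hud, norm_sub_rev xstar x₀] at h3
  have h4 : ‖x₀ - xstar‖ ≤ ‖x - x₀‖ + ‖x - u‖ + ‖xstar - u‖ := by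
    have e : x₀ - xstar = -(x - x₀) + ((x - u) - (xstar - u)) := by abel
    rw [e]
    refine (norm_add_le _ _).trans ?_
    rw [norm_neg, add_assoc]
    exact add_le_add_right (norm_sub_le _ _) _
  have h5 := pow_le_pow_left₀ (norm_nonneg _) h4 2
  have h6 : ‖x₀ - xstar‖ ^ 2 ≤ 3 * (‖x - x₀‖ ^ 2 + ‖x - u‖ ^ 2 + ‖xstar - u‖ ^ 2) := by
    nlinarith [sq_nonneg (‖x - x₀‖ - ‖x - u‖), sq_nonneg (‖x - u‖ - ‖xstar - u‖),
      sq_nonneg (‖x - x₀‖ - ‖xstar - u‖)]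
  have h7 := mul_le_mul_of_nonneg_left h6 hμ.le
  have h8 := mul_le_mul_of_nonneg_left hD hμ.le
  linarith

/-! ### Convergence of NoCK -/

theorem mean_nockStage_gap_le [NeZero n₁] [NeZero n₂] (hP : P.IsConvex)
    (hs : P.SmoothBounded L_F B_F L_G B_G) (hJ : P.JointSmooth L) {xstar : Vec N₂}
    (hmin : ∀ x, P.H xstar ≤ P.H x) {μ₀ : ℝ} (hμ : 0 < μ₀) (hL : μ₀ ≤ L) (x₀ : Vec N₂) (t : ℕ)
    (x : Vec N₂) (s : ℕ) :
    (nockStage P L L_F B_F L_G B_G 64 μ₀ x₀ t x).mean (nockProblem P μ₀ x₀ t).gap s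
      ≤ ENNReal.ofReal (1 / 12) * (nockProblem P μ₀ x₀ t).gap x := by
  have hμt : 0 < μ₀ / 2 ^ t := by positivity
  have hLt : μ₀ / 2 ^ t ≤ L :=
    (div_le_self hμ.le (one_le_pow₀ (by norm_num))).trans hL
  obtain ⟨u, hu⟩ := hP.isStage_regularize hs hJ hmin hμt x₀
  exact mean_sock_gap_le hu (sockParams_isAdmissible hμt hLt) x s

/-- With `μ_t D_x = D_H/2^t`, the recursion closes because `1/4 + 1/12 ≤ 1/2`. -/
theorem mean_nock_gap_le [NeZero n₁] [NeZero n₂] (hP : P.IsConvex)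
    (hs : P.SmoothBounded L_F B_F L_G B_G) (hJ : P.JointSmooth L) {xstar : Vec N₂}
    (hmin : ∀ x, P.H xstar ≤ P.H x) {D_H D_x : ℝ} (hH : 0 < D_H) (hx : 0 < D_x)
    (hL : D_H / D_x ≤ L) {x₀ : Vec N₂} (hx₀ : x₀ ∈ P.dom)
    (hDH : P.HReal x₀ - P.HReal xstar ≤ D_H) (hD : ‖x₀ - xstar‖ ^ 2 ≤ D_x) (t s : ℕ) :
    (nock P L L_F B_F L_G B_G 64 (D_H / D_x) x₀ t).mean (nockProblem P (D_H / D_x) x₀ t).gap s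
      ≤ ENNReal.ofReal (D_H / 2 ^ t) := by
  have hμ : 0 < D_H / D_x := by positivity
  induction t with
  | zero =>
    refine (Comp.mean_pure _ _ _).le.trans ?_
    obtain ⟨u, hu⟩ := hP.isStage_regularize hs hJ hmin
      (by positivity : 0 < D_H / D_x / 2 ^ 0) x₀
    rw [pow_zero, div_one]
    exact gap_regularize_start_le hP hmin (by positivity) hx₀ hDH hu
  | succ t ih =>
    set μ := D_H / D_x / 2 ^ t with hμt
    have hμp : 0 < μ := by positivity
    have hhalf : D_H / D_x / 2 ^ (t + 1) = μ / 2 := by rw [pow_succ, ← div_div]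
    obtain ⟨u, hu⟩ := hP.isStage_regularize hs hJ hmin hμp x₀
    obtain ⟨v, hv⟩ := hP.isStage_regularize hs hJ hmin (half_pos hμp) x₀
    have hgap : ∀ x, (nockProblem P (D_H / D_x) x₀ (t + 1)).gap x
        ≤ ENNReal.ofReal (μ * D_x / 4) + (nockProblem P (D_H / D_x) x₀ t).gap x := fun x => by
      rw [nockProblem, hhalf]
      exact gap_regularize_half_le hP hmin hμp hD hu hv x
    refine (Comp.mean_mono _ hgap s).trans ?_
    rw [Comp.mean_const_add]
    have h1 := Comp.mean_bind_le (nock P L L_F B_F L_G B_G 64 (D_H / D_x) x₀ t)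
      (fun x => nockStage P L L_F B_F L_G B_G 64 (D_H / D_x) x₀ t x)
      (nockProblem P (D_H / D_x) x₀ t).gap
      (fun x => ENNReal.ofReal (1 / 12) * (nockProblem P (D_H / D_x) x₀ t).gap x)
      (fun x s => mean_nockStage_gap_le hP hs hJ hmin hμ hL x₀ t x s) s
    rw [Comp.mean_const_mul] at h1
    have h2 := h1.trans (mul_le_mul_right ih _)
    refine (add_le_add_right h2 _).trans ?_
    rw [← ENNReal.ofReal_mul (by norm_num), ← ENNReal.ofReal_add (by positivity) (by positivity)]
    apply ENNReal.ofReal_le_ofReal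
    have h3 : μ * D_x = D_H / 2 ^ t := by
      rw [hμt]
      field_simp
    rw [h3, pow_succ, ← div_div]
    have : 0 < D_H / 2 ^ t := by positivity
    linarith

/-- The gap of `H` itself is compared with that of the stage just completed, where `1/3 + 2/12 =
1/2`. -/
theorem mean_nock_succ_gap_le [NeZero n₁] [NeZero n₂] (hP : P.IsConvex)
    (hs : P.SmoothBounded L_F B_F L_G B_G) (hJ : P.JointSmooth L) {xstar : Vec N₂}
    (hmin : ∀ x, P.H xstar ≤ P.H x) {D_H D_x : ℝ} (hH : 0 < D_H) (hx : 0 < D_x)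
    (hL : D_H / D_x ≤ L) {x₀ : Vec N₂} (hx₀ : x₀ ∈ P.dom)
    (hDH : P.HReal x₀ - P.HReal xstar ≤ D_H) (hD : ‖x₀ - xstar‖ ^ 2 ≤ D_x) (t s : ℕ) :
    (nock P L L_F B_F L_G B_G 64 (D_H / D_x) x₀ (t + 1)).mean P.gap s
      ≤ ENNReal.ofReal (D_H / 2 ^ (t + 1)) := by
  have hμ : 0 < D_H / D_x := by positivity
  set μ := D_H / D_x / 2 ^ t with hμt
  have hμp : 0 < μ := by positivity
  obtain ⟨u, hu⟩ := hP.isStage_regularize hs hJ hmin hμp x₀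
  have hgap : ∀ x, P.gap x ≤ ENNReal.ofReal (μ * D_x / 3)
      + ENNReal.ofReal 2 * (nockProblem P (D_H / D_x) x₀ t).gap x :=
    gap_le_gap_regularize hP hmin hμp hD hu
  refine (Comp.mean_mono _ hgap s).trans ?_
  rw [Comp.mean_const_add, Comp.mean_const_mul]
  have h1 := Comp.mean_bind_le (nock P L L_F B_F L_G B_G 64 (D_H / D_x) x₀ t)
    (fun x => nockStage P L L_F B_F L_G B_G 64 (D_H / D_x) x₀ t x)
    (nockProblem P (D_H / D_x) x₀ t).gap
    (fun x => ENNReal.ofReal (1 / 12) * (nockProblem P (D_H / D_x) x₀ t).gap x)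
    (fun x s => mean_nockStage_gap_le hP hs hJ hmin hμ hL x₀ t x s) s
  rw [Comp.mean_const_mul] at h1
  have h2 := h1.trans (mul_le_mul_right
    (mean_nock_gap_le hP hs hJ hmin hH hx hL hx₀ hDH hD t s) _)
  refine (add_le_add_right (mul_le_mul_right h2 _) _).trans ?_
  rw [← ENNReal.ofReal_mul (by norm_num), ← ENNReal.ofReal_mul (by norm_num),
    ← ENNReal.ofReal_add (by positivity) (by positivity)]
  apply ENNReal.ofReal_le_ofReal
  have h3 : μ * D_x = D_H / 2 ^ t := by
    rw [hμt]
    field_simp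
  rw [h3, pow_succ, ← div_div]
  linarith

/-! ### The number of oracle calls -/

/-- A sequence growing at least by `4/3` has sums dominated by four times the last term. -/
theorem sum_range_succ_le_of_growth {b : ℕ → ℝ} (h0 : 0 ≤ b 0) (h : ∀ t, 4 * b t ≤ 3 * b (t + 1))
    (T : ℕ) : ∑ t ∈ Finset.range (T + 1), b t ≤ 4 * b T := by
  induction T with
  | zero => simpa using by linarith
  | succ T ih =>
    rw [Finset.sum_range_succ]
    linarith [h T]

theorem max_one_ceil_le {v w : ℝ} (hv : 0 ≤ v) (hw : v ≤ w) :
    ((max 1 ⌈v⌉₊ : ℕ) : ℝ) ≤ w + 1 := by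
  rw [Nat.cast_max, Nat.cast_one]
  exact max_le (by linarith) ((Nat.ceil_lt_add_one hv).le.trans (by linarith))

/-- The rounding of the batch sizes and the proximal calls add `6` per inner iteration; with `n₁ ≥
1` this merges into `7 n₁`. -/
theorem stage_cost_le [NeZero n₁] {μ M : ℝ} (hμ : 0 < μ) (hL : μ ≤ L)
    (hA : B_G ^ 4 * L_F ^ 2 ≤ M) (hB : B_F ^ 2 * L_G ^ 2 ≤ M) :
    ((2 * n₂ + n₁ + (sockParams L L_F B_F L_G B_G μ).m *
      (2 * (sockParams L L_F B_F L_G B_G μ).A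
        + 2 * (sockParams L L_F B_F L_G B_G μ).B + n₁ + 2) : ℕ) : ℝ)
      ≤ 2 * ((n₁ : ℝ) + n₂) + 7 * n₁ * √(L / μ) + 2880 * M * (√(L / μ) / μ ^ 2) := by
  have hm : ((sockParams L L_F B_F L_G B_G μ).m : ℝ) ≤ √(L / μ) :=
    ceil_half_sqrt_le ((one_le_div hμ).2 hL)
  have h1 : ((sockParams L L_F B_F L_G B_G μ).A : ℝ) ≤ 720 * M / μ ^ 2 + 1 :=
    max_one_ceil_le (by positivity)
      (div_le_div_of_nonneg_right (by rw [mul_assoc]; linarith) (by positivity))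
  have h2 : ((sockParams L L_F B_F L_G B_G μ).B : ℝ) ≤ 720 * M / μ ^ 2 + 1 :=
    max_one_ceil_le (by positivity)
      (div_le_div_of_nonneg_right (by rw [mul_assoc]; linarith) (by positivity))
  have hn : (1 : ℝ) ≤ n₁ := by exact_mod_cast Nat.pos_of_ne_zero (NeZero.ne n₁)
  push_cast
  have h3 : ((sockParams L L_F B_F L_G B_G μ).m : ℝ) *
      (2 * (sockParams L L_F B_F L_G B_G μ).A
        + 2 * (sockParams L L_F B_F L_G B_G μ).B + n₁ + 2)
      ≤ √(L / μ) * (4 * (720 * M / μ ^ 2) + 7 * n₁) :=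
    mul_le_mul hm (by linarith) (by positivity) (Real.sqrt_nonneg _)
  have h4 : √(L / μ) * (4 * (720 * M / μ ^ 2) + 7 * n₁)
      = 7 * n₁ * √(L / μ) + 2880 * M * (√(L / μ) / μ ^ 2) := by
    ring
  have : (0 : ℝ) ≤ n₁ := by positivity
  linarith

theorem four_mul_sqrt_le {x : ℝ} (hx : 0 ≤ x) : 4 * √x ≤ 3 * √(2 * x) := by
  have h1 : 4 * √x = √(16 * x) := by
    rw [Real.sqrt_mul (by norm_num), show (16 : ℝ) = 4 ^ 2 by norm_num, Real.sqrt_sq (by norm_num)]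
  have h2 : 3 * √(2 * x) = √(9 * (2 * x)) := by
    rw [Real.sqrt_mul (by norm_num : (0 : ℝ) ≤ 9), show (9 : ℝ) = 3 ^ 2 by norm_num,
      Real.sqrt_sq (by norm_num)]
  rw [h1, h2]
  exact Real.sqrt_le_sqrt (by linarith)

/-- For `r ≥ 2` the rounding at most doubles the logarithm, and `2 / log 2 < 3`. -/
theorem natCast_le_three_mul_log {r : ℝ} (hr : 2 ≤ r) :
    (⌈Real.logb 2 r⌉₊ : ℝ) ≤ 3 * Real.log r := by
  have h2 := Real.log_two_gt_d9
  have hlog : Real.log 2 ≤ Real.log r := Real.log_le_log (by norm_num) hr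
  have hnn : 0 ≤ Real.logb 2 r := Real.logb_nonneg (by norm_num) (by linarith)
  have h3 := Nat.ceil_lt_add_one hnn
  have h4 : Real.logb 2 r + 1 ≤ 2 * Real.logb 2 r := by
    have : 1 ≤ Real.logb 2 r := by
      rw [Real.logb, one_le_div (by linarith)]
      exact hlog
    linarith
  have h5 : 2 * Real.logb 2 r ≤ 3 * Real.log r := by
    rw [Real.logb, ← mul_div_assoc, div_le_iff₀ (by linarith)]
    nlinarith
  linarith

theorem rpow_five_halves {x : ℝ} (hx : 0 < x) : x ^ (5 / 2 : ℝ) = x ^ 2 * √x := by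
  rw [Real.sqrt_eq_rpow, ← Real.rpow_natCast, ← Real.rpow_add hx]
  norm_num

theorem total_cost_le [NeZero n₁] {D_H D_x ε : ℝ} (hx : 0 < D_x) (hε : 0 < ε)
    (hH : 2 * ε ≤ D_H) (hL : D_H / D_x ≤ L) (c : ℕ → ℕ)
    (hc : ∀ t, c t = 64 * (2 * n₂ + n₁ +
      (sockParams L L_F B_F L_G B_G (D_H / D_x / 2 ^ t)).m *
      (2 * (sockParams L L_F B_F L_G B_G (D_H / D_x / 2 ^ t)).A
        + 2 * (sockParams L L_F B_F L_G B_G (D_H / D_x / 2 ^ t)).B + n₁ + 2))) :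
    ((∑ t ∈ Finset.range ⌈Real.logb 2 (D_H / ε)⌉₊, c t : ℕ) : ℝ) ≤ 1000000 *
      (((n₁ : ℝ) + (n₂ : ℝ)) * Real.log (D_H / ε)
        + D_x ^ (5 / 2 : ℝ) * √L * max (B_G ^ 4 * L_F ^ 2) (B_F ^ 2 * L_G ^ 2)
            / ε ^ (5 / 2 : ℝ)
        + √(D_x * L) * (n₁ : ℝ) / √ε) := by
  have hHp : 0 < D_H := by linarith
  have hr : 2 ≤ D_H / ε := by rwa [le_div_iff₀ hε]
  have hLp : 0 < L := lt_of_lt_of_le (by positivity) hL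
  set M := max (B_G ^ 4 * L_F ^ 2) (B_F ^ 2 * L_G ^ 2) with hM
  have hM0 : 0 ≤ M := le_trans (by positivity) (le_max_left _ _)
  have hTlog := natCast_le_three_mul_log hr
  obtain ⟨k, hk⟩ : ∃ k, ⌈Real.logb 2 (D_H / ε)⌉₊ = k + 1 :=
    Nat.exists_eq_succ_of_ne_zero (by
      have : 0 < Real.logb 2 (D_H / ε) := Real.logb_pos (by norm_num) (by linarith)
      exact (Nat.ceil_pos.2 this).ne')
  -- The last stage has index `k = T - 1`, strictly below the logarithm before rounding; hence
  -- `1/μ_k ≤ D_x/ε`.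
  have hklt : (2 : ℝ) ^ k < D_H / ε := by
    have : (k : ℝ) < Real.logb 2 (D_H / ε) := Nat.lt_ceil.1 (by omega)
    rw [Real.lt_logb_iff_rpow_lt (by norm_num) (by linarith), Real.rpow_natCast] at this
    exact this
  rw [hk] at hTlog ⊢
  set μ : ℕ → ℝ := fun t => D_H / D_x / 2 ^ t with hμ
  have hμp : ∀ t, 0 < μ t := fun t => by positivity
  have hμL : ∀ t, μ t ≤ L := fun t =>
    (div_le_self (by positivity) (one_le_pow₀ (by norm_num))).trans hL
  have hμs : ∀ t, μ (t + 1) = μ t / 2 := fun t => by simp only [hμ, pow_succ, ← div_div]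
  have hinv : 1 / μ k ≤ D_x / ε := by
    rw [lt_div_iff₀ hε] at hklt
    simp only [hμ]
    rw [div_div, one_div_div, div_le_div_iff₀ hHp hε]
    nlinarith
  have hstage : ∀ t, (c t : ℝ) ≤ 64 * (2 * ((n₁ : ℝ) + n₂) + 7 * n₁ * √(L / μ t)
      + 2880 * M * (√(L / μ t) / μ t ^ 2)) := fun t => by
    rw [hc t, Nat.cast_mul]
    exact mul_le_mul_of_nonneg_left
      (stage_cost_le (hμp t) (hμL t) (le_max_left _ _) (le_max_right _ _)) (by norm_num)
  have hgrow : ∀ t, 4 * √(L / μ t) ≤ 3 * √(L / μ (t + 1)) := fun t => by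
    have : L / μ (t + 1) = 2 * (L / μ t) := by
      rw [hμs]
      field_simp
    rw [this]
    have := hμp t
    exact four_mul_sqrt_le (by positivity)
  have hgrow2 : ∀ t, 4 * (√(L / μ t) / μ t ^ 2) ≤ 3 * (√(L / μ (t + 1)) / μ (t + 1) ^ 2) :=
    fun t => by
      have h1 := hμp t
      have h2 : √(L / μ (t + 1)) / μ (t + 1) ^ 2 = 4 * (√(L / μ (t + 1)) / μ t ^ 2) := by
        rw [hμs t]
        field_simp
        norm_num
      have h3 := div_le_div_of_nonneg_right (hgrow t) (by positivity : 0 ≤ μ t ^ 2)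
      have h4 : 0 ≤ √(L / μ (t + 1)) / μ t ^ 2 := by positivity
      rw [mul_div_assoc, mul_div_assoc] at h3
      rw [h2]
      linarith
  have hs1 := sum_range_succ_le_of_growth (b := fun t => √(L / μ t)) (Real.sqrt_nonneg _) hgrow k
  have hs2 := sum_range_succ_le_of_growth (b := fun t => √(L / μ t) / μ t ^ 2)
    (by positivity) hgrow2 k
  have hb : √(L / μ k) ≤ √(D_x * L) / √ε := by
    rw [← Real.sqrt_div (by positivity)]
    apply Real.sqrt_le_sqrt
    have := mul_le_mul_of_nonneg_left hinv hLp.le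
    calc L / μ k = L * (1 / μ k) := by ring
      _ ≤ L * (D_x / ε) := this
      _ = D_x * L / ε := by ring
  have hb2 : √(L / μ k) / μ k ^ 2 ≤ D_x ^ (5 / 2 : ℝ) * √L / ε ^ (5 / 2 : ℝ) := by
    rw [rpow_five_halves hx, rpow_five_halves hε]
    have h1 : (1 / μ k) ^ 2 ≤ (D_x / ε) ^ 2 :=
      pow_le_pow_left₀ (by have := hμp k; positivity) hinv 2
    calc √(L / μ k) / μ k ^ 2 = √(L / μ k) * (1 / μ k) ^ 2 := by ring
      _ ≤ √(D_x * L) / √ε * (D_x / ε) ^ 2 :=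
        mul_le_mul hb h1 (by positivity) (by positivity)
      _ = D_x ^ 2 * √D_x * √L / (ε ^ 2 * √ε) := by
        rw [Real.sqrt_mul hx.le]
        field_simp
  have hsum : ∑ t ∈ Finset.range (k + 1), (64 * (2 * ((n₁ : ℝ) + n₂) + 7 * n₁ * √(L / μ t)
      + 2880 * M * (√(L / μ t) / μ t ^ 2)))
      = 64 * (((k + 1 : ℕ) : ℝ) * (2 * ((n₁ : ℝ) + n₂))
        + 7 * n₁ * ∑ t ∈ Finset.range (k + 1), √(L / μ t)
        + 2880 * M * ∑ t ∈ Finset.range (k + 1), √(L / μ t) / μ t ^ 2) := by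
    simp only [Finset.sum_add_distrib, ← Finset.mul_sum, Finset.sum_const, Finset.card_range,
      nsmul_eq_mul]
    push_cast
    ring
  rw [Nat.cast_sum]
  refine (Finset.sum_le_sum fun t _ => hstage t).trans ?_
  rw [hsum]
  have hlog0 : 0 ≤ Real.log (D_H / ε) := Real.log_nonneg (by linarith)
  have e1 : ((k + 1 : ℕ) : ℝ) * (2 * ((n₁ : ℝ) + n₂))
      ≤ 6 * (((n₁ : ℝ) + n₂) * Real.log (D_H / ε)) := by
    have := mul_le_mul_of_nonneg_right hTlog (by positivity : 0 ≤ 2 * ((n₁ : ℝ) + n₂))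
    linarith
  have e2 : 7 * n₁ * ∑ t ∈ Finset.range (k + 1), √(L / μ t)
      ≤ 28 * (√(D_x * L) * (n₁ : ℝ) / √ε) := by
    have h1 : ∑ t ∈ Finset.range (k + 1), √(L / μ t) ≤ 4 * (√(D_x * L) / √ε) := by linarith
    have := mul_le_mul_of_nonneg_left h1 (by positivity : 0 ≤ 7 * (n₁ : ℝ))
    refine this.trans (le_of_eq (by ring))
  have e3 : 2880 * M * ∑ t ∈ Finset.range (k + 1), √(L / μ t) / μ t ^ 2
      ≤ 11520 * (D_x ^ (5 / 2 : ℝ) * √L * M / ε ^ (5 / 2 : ℝ)) := by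
    have h1 : ∑ t ∈ Finset.range (k + 1), √(L / μ t) / μ t ^ 2
        ≤ 4 * (D_x ^ (5 / 2 : ℝ) * √L / ε ^ (5 / 2 : ℝ)) := by linarith
    have := mul_le_mul_of_nonneg_left h1 (by positivity : 0 ≤ 2880 * M)
    refine this.trans (le_of_eq (by ring))
  have p1 : 0 ≤ ((n₁ : ℝ) + n₂) * Real.log (D_H / ε) := by positivity
  have p2 : 0 ≤ √(D_x * L) * (n₁ : ℝ) / √ε := by positivity
  have p3 : 0 ≤ D_x ^ (5 / 2 : ℝ) * √L * M / ε ^ (5 / 2 : ℝ) := by positivity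
  -- The three constants are `64 * 6`, `64 * 28` and `64 * 11520 = 737280`, all below `1000000`.
  linarith

end

end CompOpt

/-! ### Assembly of the three claims. -/

theorem theorem3 :
    ∃ (S : ℕ) (C : ℝ), 0 < C ∧
      ∀ (N₁ N₂ n₁ n₂ : ℕ) [NeZero n₁] [NeZero n₂] (P : CompOpt.Problem N₁ N₂ n₁ n₂)
        (L L_F B_F L_G B_G D_H D_x : ℝ) (x₀ xstar : CompOpt.Vec N₂),
        P.IsConvex →
        P.SmoothBounded L_F B_F L_G B_G →
        P.JointSmooth L →
        (∀ x, P.H xstar ≤ P.H x) →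
        P.H x₀ ≤ P.H xstar + (D_H : EReal) →
        ‖x₀ - xstar‖ ^ 2 ≤ D_x →
        0 < D_x →
        D_H / D_x ≤ L →
        ∀ ε : ℝ, 0 < ε →
          let μ₀ : ℝ := D_H / D_x
          let T : ℕ := ⌈Real.logb 2 (D_H / ε)⌉₊
          -- every stage meets the stopping rule of NoCK, whatever its starting point
          (∀ t < T, ∀ x : CompOpt.Vec N₂,
            CompOpt.expect (CompOpt.nockStage P L L_F B_F L_G B_G S μ₀ x₀ t x).law
                (CompOpt.nockProblem P μ₀ x₀ t).gap
              ≤ (CompOpt.nockProblem P μ₀ x₀ t).gap x / 4) ∧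
          -- the output is a stochastic solution
          P.IsStochasticSol ε (CompOpt.nock P L L_F B_F L_G B_G S μ₀ x₀ T).law ∧
          -- the number of oracle calls, in every outcome
          (2 * ε ≤ D_H →
            ∀ r ∈ (CompOpt.nock P L L_F B_F L_G B_G S μ₀ x₀ T).outcome.support,
              (r.2 : ℝ) ≤ C *
                (((n₁ : ℝ) + (n₂ : ℝ)) * Real.log (D_H / ε)
                  + D_x ^ (5 / 2 : ℝ) * √L * max (B_G ^ 4 * L_F ^ 2) (B_F ^ 2 * L_G ^ 2)
                      / ε ^ (5 / 2 : ℝ)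
                  + √(D_x * L) * (n₁ : ℝ) / √ε)) := by
  refine ⟨64, 1000000, by norm_num, ?_⟩
  intro N₁ N₂ n₁ n₂ _ _ P L L_F B_F L_G B_G D_H D_x x₀ xstar hP hs hJ hmin hH hD hDx hL ε hε μ₀ T
  have hsd := CompOpt.Problem.mem_dom_of_isMin hP hmin
  rw [← hP.coe_HReal hsd, ← EReal.coe_add] at hH
  have hx₀ : x₀ ∈ P.dom := by
    by_contra hx
    rw [CompOpt.Problem.H_eq_top hx] at hH
    exact absurd (top_le_iff.1 hH) (EReal.coe_ne_top _)
  rw [← hP.coe_HReal hx₀, EReal.coe_le_coe_iff] at hH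
  have hDH : P.HReal x₀ - P.HReal xstar ≤ D_H := by linarith
  have hDH0 : 0 ≤ D_H := le_trans (sub_nonneg.2 (hP.HReal_min hmin hsd hx₀)) hDH
  -- If `D_H = 0` then the logarithm takes its default value `0` and there is no stage; so every
  -- stage has `μ₀ > 0`.
  have hpos : 0 < T → 0 < D_H := fun hT => by
    refine lt_of_le_of_ne hDH0 fun h => ?_
    simp [T, ← h] at hT
  refine ⟨fun t ht x => ?_, ?_, fun hε2 r hr => ?_⟩
  · have hH0 := hpos (by omega)
    rw [CompOpt.Comp.expect_law]
    refine (CompOpt.mean_nockStage_gap_le hP hs hJ hmin (by positivity) hL x₀ t x 0).trans ?_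
    rw [ENNReal.div_eq_inv_mul]
    refine mul_le_mul_left ?_ _
    rw [← ENNReal.ofReal_ofNat 4, ← ENNReal.ofReal_inv_of_pos (by norm_num)]
    exact ENNReal.ofReal_le_ofReal (by norm_num)
  · rw [CompOpt.Problem.IsStochasticSol, CompOpt.Comp.expect_law]
    have hlog := Nat.le_ceil (Real.logb 2 (D_H / ε))
    -- With no stage, `D_H ≤ ε` and the starting point is already a solution.
    rcases Nat.eq_zero_or_pos T with hT | hT
    · have hle : D_H ≤ ε := by
        by_contra! h
        have h1 : 0 < Real.logb 2 (D_H / ε) :=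
          Real.logb_pos (by norm_num) ((one_lt_div hε).2 h)
        have := Nat.ceil_pos.2 h1
        omega
      rw [hT]
      refine (CompOpt.Comp.mean_pure _ _ _).le.trans ?_
      rw [hP.gap_eq hmin hsd hx₀]
      exact ENNReal.ofReal_le_ofReal (hDH.trans hle)
    · have hH0 := hpos hT
      obtain ⟨k, hk⟩ := Nat.exists_eq_succ_of_ne_zero hT.ne'
      have hpow : D_H / 2 ^ T ≤ ε := by
        rw [Real.logb_le_iff_le_rpow (by norm_num) (by positivity), Real.rpow_natCast] at hlog
        rw [div_le_iff₀ (by positivity)]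
        rw [div_le_iff₀ hε] at hlog
        linarith
      rw [hk] at hpow ⊢
      exact (CompOpt.mean_nock_succ_gap_le hP hs hJ hmin hH0 hDx hL hx₀ hDH hD k 0).trans
        (ENNReal.ofReal_le_ofReal hpow)
  · have h := CompOpt.hasCost_nock P L L_F B_F L_G B_G 64 μ₀ x₀ _ (fun t => rfl) T 0 r hr
    rw [h, zero_add]
    exact CompOpt.total_cost_le hDx hε hε2 hL _ (fun t => rfl)
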